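/- Let $d\ge 1$ and let $\mathcal S_N$ be the set of self-avoiding nearest-neighbour paths $S=(S_0,\dots,S_N)$ in $\mathbb Z^d$ with $S_0=0$. Write $x\sim y$ when $x,y$ are neighbours and $|x-y|$ for the graph ($\ell^1$) distance. Let $\omega=(\omega_e)$ be i.i.d. Bernoulli variables of parameter $p\in[0,1]$ indexed by the edges of $\mathbb Z^d$, with law $\mathbb P_p$; an edge is open for $\omega$ if $\omega_e=1$, and a path is open for $\omega$ if all its edges are. For $S\in\mathcal S_N$ let $\tilde\omega=\tilde\omega(S,\omega)$ be the environment with $\tilde\omega_e=1$ if $e$ is an edge of $S$ and $\tilde\omega_e=\omega_e$ otherwise, and let $$\tilde Z_N(S,\omega)=\#\{S'\in\mathcal S_N : S'\text{ is open for }\tilde\omega(S,\omega)\}.$$ For $S\in\mathcal S_N$ put $X_n=S_n-S_{n-1}$ $(1\le n\le N)$ and $$U_N=\{n\in[3,N]: S_n\sim S_{n-3}\},\qquad T_N=\{n\in[2,N-1]: X_n=X_{n-1}\},$$ $$V^2_N=\{n\in[0,N]:\ \forall m\in[0,N],\ |m-n|>2\Rightarrow |S_m-S_n|>2\}.$$ For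 $\varepsilon>0$ the set of good spines is $$\mathcal A_{\varepsilon,N}=\Big\{S\in\mathcal S_N:\ |V^2_N|\ge(1-\varepsilon)N,\ |T_N|\le\varepsilon N,\ \tfrac{(1-\varepsilon)N}{2d}\le|U_N|\le\tfrac{(1+\varepsilon)N}{2d}\Big\}.$$ **Proposition.** For every $\varepsilon>0$ there is $d_0(\varepsilon)$ such that for every $d\ge d_0(\varepsilon)$ there is $c=c(\varepsilon,d)>0$ such that for every $p\in[\frac1{2d},1]$ there is $N_0$ such that for all $N\ge N_0$ and all $S\in\mathcal A_{\varepsilon,N}$, $$\mathbb P_p\Big[\tilde Z_N(S,\omega)\le 2^{(3-6\varepsilon)N/(2d)^2}\Big]\le e^{-cN}.$$ -/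

import Mathlib

open MeasureTheory ProbabilityTheory

namespace DiluteLattice

/-- The graph distance of the lattice `ℤ^d`, that is, the `ℓ¹` distance. -/
def l1dist {d : ℕ} (x y : Fin d → ℤ) : ℤ := ∑ i, |x i - y i|

/-- The lattice `ℤ^d` with its nearest-neighbour graph structure. -/
def lattice (d : ℕ) : SimpleGraph (Fin d → ℤ) where
  Adj x y := l1dist x y = 1
  symm := ⟨fun x y h => by simpa [l1dist, abs_sub_comm] using h⟩
  loopless := ⟨fun x h => by simp [l1dist] at h⟩

/-- An environment: a state for every edge of `ℤ^d` (`true` is open, `false` is closed). -/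
abbrev Env (d : ℕ) : Type := (lattice d).edgeSet → Bool

/-- Bernoulli bond percolation: the edges are i.i.d., open with probability `p`. -/
noncomputable def percolation (d : ℕ) (p : unitInterval) : Measure (Env d) :=
  Measure.infinitePi fun _ => bernoulliMeasure true false p

/-- A sequence of `N + 1` sites `S_0, …, S_N` of `ℤ^d`. -/
abbrev SiteSeq (d N : ℕ) : Type := Fin (N + 1) → Fin d → ℤ

/-- Self-avoiding nearest-neighbour paths of length `N` started from the origin. -/
def selfAvoiding (d N : ℕ) : Set (SiteSeq d N) :=
  {S | S 0 = 0 ∧ (∀ n : Fin N, (lattice d).Adj (S n.castSucc) (S n.succ)) ∧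
    Function.Injective S}

/-- The lattice edges traversed by a path. -/
def pathEdges {d N : ℕ} (S : SiteSeq d N) : Set (lattice d).edgeSet :=
  {e | ∃ n : Fin N, (e : Sym2 (Fin d → ℤ)) = s(S n.castSucc, S n.succ)}

/-- A path is open if all of its edges are open. -/
def IsOpenPath {d N : ℕ} (ω : Env d) (S : SiteSeq d N) : Prop :=
  ∀ e ∈ pathEdges S, ω e = true

open Classical in
/-- The environment with spine `S`: the edges of `S` are opened, all others are unchanged. -/
noncomputable def spineEnv {d N : ℕ} (S : SiteSeq d N) (ω : Env d) : Env d :=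
  fun e => if e ∈ pathEdges S then true else ω e

/-- The number of self-avoiding paths of length `N` from the origin that are open for `ω`. -/
noncomputable def Z {d : ℕ} (N : ℕ) (ω : Env d) : ℕ :=
  {S' ∈ selfAvoiding d N | IsOpenPath ω S'}.ncard

/-- The number of self-avoiding paths of length `N` from the origin that are open for the
environment with spine `S`. -/
noncomputable def spineZ {d N : ℕ} (S : SiteSeq d N) (ω : Env d) : ℕ :=
  Z N (spineEnv S ω)

/-- `S_n` with `n` a natural number; used only for `n ≤ N`. -/
def site {d N : ℕ} (S : SiteSeq d N) (n : ℕ) : Fin d → ℤ := S (Fin.ofNat (N + 1) n)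

/-- The increment `X_n = S_n - S_{n-1}`, used only for `1 ≤ n ≤ N`. -/
def increment {d N : ℕ} (S : SiteSeq d N) (n : ℕ) : Fin d → ℤ := site S n - site S (n - 1)

/-- The times `n ∈ [3, N]` at which `S` completes a U-turn: `S_n` is a neighbour of `S_{n-3}`. -/
def uTurns {d N : ℕ} (S : SiteSeq d N) : Set ℕ :=
  {n | 3 ≤ n ∧ n ≤ N ∧ (lattice d).Adj (site S n) (site S (n - 3))}

/-- The times `n ≤ N - 1` with `X_n = X_{n-1}` (both increments exist only for `2 ≤ n`). -/
def straightTimes {d N : ℕ} (S : SiteSeq d N) : Set ℕ :=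
  {n | 2 ≤ n ∧ n ≤ N - 1 ∧ increment S n = increment S (n - 1)}

/-- The times `n ∈ [0, N]` such that `S` is never within distance two of `S_n`, except possibly
at times within two of `n`. -/
def isolatedTimes {d N : ℕ} (S : SiteSeq d N) : Set ℕ :=
  {n | n ≤ N ∧ ∀ m ≤ N, 2 < |(m : ℤ) - n| → 2 < l1dist (site S m) (site S n)}

/-- The good spines. -/
def goodSpines (d : ℕ) (ε : ℝ) (N : ℕ) : Set (SiteSeq d N) :=
  {S | S ∈ selfAvoiding d N ∧
    (1 - ε) * N ≤ ((isolatedTimes S).ncard : ℝ) ∧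
    ((straightTimes S).ncard : ℝ) ≤ ε * N ∧
    ((uTurns S).ncard : ℝ) ∈ Set.Icc ((1 - ε) * N / (2 * d)) ((1 + ε) * N / (2 * d))}

end DiluteLattice

/-!
The number `Z̃_N` of open paths is bounded from below by modifying the spine `S` locally, in three
ways. Write `p = 1 / (2d)`.

* A *chord* is an open edge `{S_{n-3}, S_n}` at a U-turn; using it shortens the path by two steps.
  There are about `(1 - ε) N p` U-turns, hence on average about `(1 - ε) N p²` open chords.
* A *detour* replaces the edge `{S_{n-1}, S_n}` by the three edges through `S_{n-1} + e` and
  `S_n + e`, and lengthens the path by two steps. If `n` is isolated, all but ten of the `2d`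
  directions `e` lead to sites off the path, so there are about `(1 - ε) N · 2d · p³ = (1 - ε) N p²`
  open detours.
* A *flip* exchanges the increments `X_n` and `X_{n+1}`, that is, replaces `S_n` by
  `S_{n-1} + X_{n+1}`. It is possible if `n - 1` is isolated and the path neither goes straight nor
  completes a U-turn there, so there are about `(1 - 2ε) N p²` open flips.

Two modifications conflict if their times differ by at most five or if they visit a common site off
the path. Modifications that pairwise do not conflict can be used simultaneously and independently;
using as many chords as detours leaves the length equal to `N`
(`Compatible.card_le`, `le_spineZ`). If there are `m` chords, `m` detours and `f` flips, this gives
`centralBinom m * 2 ^ f ≥ 2 ^ (2 m + f) / (2 m + 1)` paths, and `2 (1 - ε) + (1 - 2ε) = 3 - 4ε`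
exceeds `3 - 6ε`, which leaves room for all the errors.

A modification is *good* if it is open and no conflicting one is. A modification conflicts with at
most fifteen modifications of each kind, a conflicting chord or flip requires one further open edge,
and a conflicting detour two (`Allowed.one_le_card_sdiff`, `Allowed.two_le_card_sdiff`,
`card_conflicts_le`), so an open modification is good with probability at least `1 - 45 p`
(`le_goodEvent`). Good events are local: colouring the modifications by the position of `S_n` modulo
`15` and by their kind, the good events of one colour are independent, and Hoeffding's inequality
in each colour class gives exponential concentration (`good_concentration`).

Finally `Z̃_N` is monotone in the environment, so that it suffices to treat `p = 1 / (2d)`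
(`bernoulliPi_mono`), and for `ε > 1/2` the event is empty because the spine itself is open.
-/

namespace DiluteLattice

/-! ### Modifying a path by chords, detours and flips -/

section Surgery

variable {V : Type*}

open Classical in
/-- The sites visited between the times `n - 1` (excluded) and `n` (included) once a path `s` has
been modified: a chord at time `k ∈ A` deletes the sites of times `k - 2` and `k - 1`, a detour at
time `n ∈ B` inserts `a n, b n` before `s n`, and a flip at time `n ∈ F` replaces `s n` by `w n`. -/
noncomputable def piece (s a b w : ℕ → V) (A B F : Finset ℕ) (n : ℕ) : List V :=
  if n + 1 ∈ A ∨ n + 2 ∈ A then []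
  else if n ∈ B then [a n, b n, s n]
  else if n ∈ F then [w n] else [s n]

/-- The path `s_0, …, s_N` modified by the chords `A`, the detours `B` and the flips `F`. -/
noncomputable def surgered (s a b w : ℕ → V) (A B F : Finset ℕ) (N : ℕ) : List V :=
  (List.range (N + 1)).flatMap (piece s a b w A B F)

/-- Compatible local modifications of the path `s_0, …, s_N` along the relation `R`: chords `A`,
detours `B` and flips `F`, at times that are pairwise more than three apart, whose new sites
(`v n` at time `n`) avoid the path and each other. -/
structure Compatible (R : V → V → Prop) (N : ℕ) (s a b w : ℕ → V) (v : ℕ → Finset V)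
    (A B F : Finset ℕ) : Prop where
  step : ∀ n < N, R (s n) (s (n + 1))
  inj : ∀ m ≤ N, ∀ n ≤ N, s m = s n → m = n
  chord : ∀ n ∈ A, 3 ≤ n ∧ n ≤ N ∧ R (s (n - 3)) (s n)
  detour : ∀ n ∈ B, 1 ≤ n ∧ n ≤ N ∧ R (s (n - 1)) (a n) ∧ R (a n) (b n) ∧ R (b n) (s n)
  detour_mem : ∀ n ∈ B, a n ∈ v n ∧ b n ∈ v n ∧ a n ≠ b n
  flip : ∀ n ∈ F, 1 ≤ n ∧ n + 1 ≤ N ∧ R (s (n - 1)) (w n) ∧ R (w n) (s (n + 1))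
  flip_mem : ∀ n ∈ F, w n ∈ v n
  new : ∀ n ∈ B ∪ F, ∀ k ≤ N, s k ∉ v n
  disj : ∀ m ∈ B ∪ F, ∀ n ∈ B ∪ F, m ≠ n → Disjoint (v m) (v n)
  sep : ∀ m ∈ A ∪ B ∪ F, ∀ n ∈ A ∪ B ∪ F, m < n → m + 3 < n
  disjAB : Disjoint A B
  disjAF : Disjoint A F
  disjBF : Disjoint B F

namespace Compatible

variable {R : V → V → Prop} {N : ℕ} {s a b w : ℕ → V} {v : ℕ → Finset V} {A B F : Finset ℕ}

/-- Some of the modifications may be left out. -/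
theorem mono (h : Compatible R N s a b w v A B F) {A' B' F' : Finset ℕ}
    (hA : A' ⊆ A) (hB : B' ⊆ B) (hF : F' ⊆ F) : Compatible R N s a b w v A' B' F' where
  step := h.step
  inj := h.inj
  chord n hn := h.chord n (hA hn)
  detour n hn := h.detour n (hB hn)
  detour_mem n hn := h.detour_mem n (hB hn)
  flip n hn := h.flip n (hF hn)
  flip_mem n hn := h.flip_mem n (hF hn)
  new n hn := h.new n (Finset.union_subset_union hB hF hn)
  disj m hm n hn := h.disj m (Finset.union_subset_union hB hF hm) n
    (Finset.union_subset_union hB hF hn)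
  sep m hm n hn := h.sep m
    (Finset.union_subset_union (Finset.union_subset_union hA hB) hF hm) n
    (Finset.union_subset_union (Finset.union_subset_union hA hB) hF hn)
  disjAB := Finset.disjoint_of_subset_left hA (Finset.disjoint_of_subset_right hB h.disjAB)
  disjAF := Finset.disjoint_of_subset_left hA (Finset.disjoint_of_subset_right hF h.disjAF)
  disjBF := Finset.disjoint_of_subset_left hB (Finset.disjoint_of_subset_right hF h.disjBF)

theorem sep' (h : Compatible R N s a b w v A B F) {m n : ℕ} (hm : m ∈ A ∨ m ∈ B ∨ m ∈ F)
    (hn : n ∈ A ∨ n ∈ B ∨ n ∈ F) : m = n ∨ m + 3 < n ∨ n + 3 < m := by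
  have hm' : m ∈ A ∪ B ∪ F := by simp only [Finset.mem_union]; tauto
  have hn' : n ∈ A ∪ B ∪ F := by simp only [Finset.mem_union]; tauto
  rcases lt_trichotomy m n with h1 | h1 | h1
  · exact Or.inr (Or.inl (h.sep m hm' n hn' h1))
  · exact Or.inl h1
  · exact Or.inr (Or.inr (h.sep n hn' m hm' h1))

theorem notAB (h : Compatible R N s a b w v A B F) {n : ℕ} (hA : n ∈ A) : n ∉ B :=
  Finset.disjoint_left.1 h.disjAB hA

theorem notAF (h : Compatible R N s a b w v A B F) {n : ℕ} (hA : n ∈ A) : n ∉ F :=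
  Finset.disjoint_left.1 h.disjAF hA

theorem notBF (h : Compatible R N s a b w v A B F) {n : ℕ} (hB : n ∈ B) : n ∉ F :=
  Finset.disjoint_left.1 h.disjBF hB

theorem piece_skip {n : ℕ} (hn : n + 1 ∈ A ∨ n + 2 ∈ A) : piece s a b w A B F n = [] := by
  simp [piece, hn]

theorem piece_detour (h : Compatible R N s a b w v A B F) {n : ℕ} (hn : n ∈ B) :
    piece s a b w A B F n = [a n, b n, s n] := by
  have h1 : ¬ (n + 1 ∈ A ∨ n + 2 ∈ A) := by
    rintro (h1 | h1)
    · have := h.sep' (Or.inl h1) (Or.inr (Or.inl hn)); omega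
    · have := h.sep' (Or.inl h1) (Or.inr (Or.inl hn)); omega
  simp [piece, hn, h1]

theorem piece_flip (h : Compatible R N s a b w v A B F) {n : ℕ} (hn : n ∈ F) :
    piece s a b w A B F n = [w n] := by
  have h1 : ¬ (n + 1 ∈ A ∨ n + 2 ∈ A) := by
    rintro (h1 | h1)
    · have := h.sep' (Or.inl h1) (Or.inr (Or.inr hn)); omega
    · have := h.sep' (Or.inl h1) (Or.inr (Or.inr hn)); omega
  have h2 : n ∉ B := fun hB => h.notBF hB hn
  simp [piece, hn, h1, h2]

theorem piece_keep {n : ℕ} (h1 : n + 1 ∉ A) (h2 : n + 2 ∉ A) (hB : n ∉ B) (hF : n ∉ F) :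
    piece s a b w A B F n = [s n] := by
  simp [piece, *]

theorem mem_piece (h : Compatible R N s a b w v A B F) {n : ℕ} {x : V}
    (hx : x ∈ piece s a b w A B F n) :
    (x = s n ∧ n + 1 ∉ A ∧ n + 2 ∉ A ∧ n ∉ F) ∨ (n ∈ B ∪ F ∧ x ∈ v n) := by
  by_cases h1 : n + 1 ∈ A ∨ n + 2 ∈ A
  · simp [piece_skip h1] at hx
  have h1' := h1
  push Not at h1
  by_cases hB : n ∈ B
  · rw [h.piece_detour hB] at hx
    have := h.detour_mem n hB
    have := h.notBF hB
    simp only [List.mem_cons, List.not_mem_nil, or_false] at hx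
    rcases hx with rfl | rfl | rfl <;> simp [*]
  by_cases hF : n ∈ F
  · rw [h.piece_flip hF] at hx
    have := h.flip_mem n hF
    simp only [List.mem_cons, List.not_mem_nil, or_false] at hx
    subst hx
    simp [*]
  · rw [piece_keep h1.1 h1.2 hB hF] at hx
    simp_all

theorem mem_surgered {x : V} :
    x ∈ surgered s a b w A B F N ↔ ∃ n ≤ N, x ∈ piece s a b w A B F n := by
  simp [surgered]

theorem nodup (h : Compatible R N s a b w v A B F) : (surgered s a b w A B F N).Nodup := by
  rw [surgered, List.nodup_flatMap]
  refine ⟨fun n hn => ?_, ?_⟩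
  · have hn : n ≤ N := by simpa [Nat.lt_succ_iff] using hn
    by_cases h1 : n + 1 ∈ A ∨ n + 2 ∈ A
    · simp [piece_skip h1]
    push Not at h1
    by_cases hB : n ∈ B
    · rw [h.piece_detour hB]
      obtain ⟨ha, hb, hab⟩ := h.detour_mem n hB
      have := h.new n (by simp [hB]) n hn
      have h2 : a n ≠ s n := fun h3 => this (h3 ▸ ha)
      have h3 : b n ≠ s n := fun h3 => this (h3 ▸ hb)
      simp [hab, h2, h3]
    by_cases hF : n ∈ F
    · simp [h.piece_flip hF]
    · simp [piece_keep h1.1 h1.2 hB hF]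
  · refine List.Nodup.pairwise_of_forall_ne List.nodup_range fun m hm n hn hmn => ?_
    have hm : m ≤ N := by simpa [Nat.lt_succ_iff] using hm
    have hn : n ≤ N := by simpa [Nat.lt_succ_iff] using hn
    intro x hxm hxn
    rcases h.mem_piece hxm with ⟨rfl, -⟩ | ⟨hm1, hm2⟩ <;>
      rcases h.mem_piece hxn with ⟨h2, -⟩ | ⟨hn1, hn2⟩
    · exact hmn (h.inj m hm n hn h2)
    · exact h.new n hn1 m hm hn2
    · exact h.new m hm1 n hn (h2 ▸ hm2)
    · exact Finset.disjoint_left.1 (h.disj m hm1 n hn1 hmn) hm2 hn2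

theorem length_surgered (h : Compatible R N s a b w v A B F) (hAB : A.card = B.card) :
    (surgered s a b w A B F N).length = N + 1 := by
  classical
  -- A detour at `n` adds two sites, a chord at `n` removes those of times `n - 2` and `n - 1`.
  have hpiece (n : ℕ) : (((piece s a b w A B F n).length : ℕ) : ℤ) =
      1 + 2 * (if n ∈ B then 1 else 0) - (if n + 1 ∈ A then 1 else 0)
        - (if n + 2 ∈ A then 1 else 0) := by
    by_cases h1 : n + 1 ∈ A
    · have h2 : n + 2 ∉ A := fun h2 => by
        have := h.sep' (Or.inl h1) (Or.inl h2); omega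
      have hB : n ∉ B := fun h2 => by
        have := h.sep' (Or.inl h1) (Or.inr (Or.inl h2)); omega
      simp [piece_skip (Or.inl h1), h1, h2, hB]
    by_cases h2 : n + 2 ∈ A
    · have hB : n ∉ B := fun h3 => by
        have := h.sep' (Or.inl h2) (Or.inr (Or.inl h3)); omega
      simp [piece_skip (Or.inr h2), h1, h2, hB]
    by_cases hB : n ∈ B
    · simp [h.piece_detour hB, h1, h2, hB]
    by_cases hF : n ∈ F
    · simp [h.piece_flip hF, h1, h2, hB]
    · simp [piece_keep h1 h2 hB hF, h1, h2, hB]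
  have hsumB : ∑ n ∈ Finset.range (N + 1), (if n ∈ B then (1 : ℤ) else 0) = B.card := by
    rw [Finset.sum_ite_mem, Finset.inter_eq_right.2]
    · simp
    · intro n hn; have := (h.detour n hn).2.1; simp; omega
  have hsumA (j : ℕ) (hj : j ≤ 3) :
      ∑ n ∈ Finset.range (N + 1), (if n + j ∈ A then (1 : ℤ) else 0) = A.card := by
    rw [← Finset.sum_filter, Finset.sum_const, nsmul_eq_mul, mul_one]
    congr 1
    refine Finset.card_nbij (fun n => n + j) ?_ ?_ ?_
    · intro n hn
      simpa using (Finset.mem_filter.1 hn).2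
    · intro n _ m _ hnm
      simpa using hnm
    · intro n hn
      have hn : n ∈ A := hn
      have := h.chord n hn
      refine ⟨n - j, ?_, ?_⟩
      · have : n - j + j = n := by omega
        simp [this, hn]; omega
      · show n - j + j = n
        omega
  have : (((surgered s a b w A B F N).length : ℕ) : ℤ) = N + 1 := by
    rw [surgered, List.length_flatMap]
    have h1 : ((List.range (N + 1)).map fun n => (piece s a b w A B F n).length).sum =
        ∑ n ∈ Finset.range (N + 1), (piece s a b w A B F n).length := by
      simp [List.sum_range_succ, Finset.sum, Finset.range, Multiset.range]
    rw [h1]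
    push_cast
    rw [Finset.sum_congr rfl fun n _ => hpiece n, Finset.sum_sub_distrib, Finset.sum_sub_distrib,
      Finset.sum_add_distrib, ← Finset.mul_sum, hsumB, hsumA 1 (by omega), hsumA 2 (by omega), hAB]
    simp
    ring
  exact_mod_cast this

open Classical in
/-- The modified path up to a time `k` whose site is not deleted by a chord is an `R`-chain that ends
at the current site. -/
theorem isChain_aux (h : Compatible R N s a b w v A B F) (k : ℕ) :
    k ≤ N → k + 1 ∉ A → k + 2 ∉ A →
      (surgered s a b w A B F k).IsChain R ∧
      (surgered s a b w A B F k).getLast? = some (if k ∈ F then w k else s k) := by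
  have hsucc (k : ℕ) : surgered s a b w A B F (k + 1) =
      surgered s a b w A B F k ++ piece s a b w A B F (k + 1) := by
    simp [surgered, List.range_succ]
  induction k using Nat.strong_induction_on with
  | _ k ih =>
  intro hk h1 h2
  rcases Nat.eq_zero_or_pos k with rfl | hpos
  · have hB : 0 ∉ B := fun hB => by have := h.detour 0 hB; omega
    have hF : 0 ∉ F := fun hF => by have := h.flip 0 hF; omega
    simp [surgered, piece_keep h1 h2 hB hF, hF]
  by_cases hkA : k ∈ A
  · obtain ⟨h3, -, hR⟩ := h.chord k hkA
    obtain ⟨j, rfl⟩ : ∃ j, k = j + 3 := ⟨k - 3, by omega⟩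
    have hsepA (i : ℕ) (hi : i < j + 3) (hij : j ≤ i) : i ∉ A ∧ i ∉ B ∧ i ∉ F := by
      refine ⟨fun hi => ?_, fun hi => ?_, fun hi => ?_⟩
      · have := h.sep' (Or.inl hkA) (Or.inl hi); omega
      · have := h.sep' (Or.inl hkA) (Or.inr (Or.inl hi)); omega
      · have := h.sep' (Or.inl hkA) (Or.inr (Or.inr hi)); omega
    obtain ⟨ih1, ih2⟩ := ih j (by omega) (by omega) (hsepA _ (by omega) (by omega)).1
      (hsepA _ (by omega) (by omega)).1
    have hB := h.notAB hkA
    have hF := h.notAF hkA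
    rw [if_neg (hsepA j (by omega) (by omega)).2.2] at ih2
    rw [hsucc, hsucc, hsucc, piece_keep h1 h2 hB hF,
      piece_skip (n := j + 1) (Or.inr hkA), piece_skip (n := j + 1 + 1) (Or.inl hkA)]
    simp only [List.append_nil, hF, if_false]
    refine ⟨List.isChain_append.2 ⟨ih1, by simp, ?_⟩, by simp⟩
    simpa [ih2] using hR
  · obtain ⟨j, rfl⟩ : ∃ j, k = j + 1 := ⟨k - 1, by omega⟩
    obtain ⟨ih1, ih2⟩ := ih j (by omega) (by omega) hkA h1
    have hstep := h.step j (by omega)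
    have hjF (hk : j + 1 ∈ B ∨ j + 1 ∈ F) : j ∉ F := fun hj => by
      have := h.sep' (Or.inr hk) (Or.inr (Or.inr hj)); omega
    rw [hsucc]
    by_cases hB : j + 1 ∈ B
    · rw [if_neg (hjF (Or.inl hB))] at ih2
      obtain ⟨-, -, r1, r2, r3⟩ := h.detour _ hB
      rw [h.piece_detour hB, if_neg (h.notBF hB)]
      refine ⟨List.isChain_append.2 ⟨ih1, by simp [r2, r3], ?_⟩, by simp⟩
      simpa [ih2] using r1
    by_cases hF : j + 1 ∈ F
    · rw [if_neg (hjF (Or.inr hF))] at ih2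
      obtain ⟨-, -, r1, r2⟩ := h.flip _ hF
      rw [h.piece_flip hF, if_pos hF]
      refine ⟨List.isChain_append.2 ⟨ih1, by simp, ?_⟩, by simp⟩
      simpa [ih2] using r1
    · rw [piece_keep h1 h2 hB hF, if_neg hF]
      refine ⟨List.isChain_append.2 ⟨ih1, by simp, ?_⟩, by simp⟩
      rw [ih2]
      by_cases hF' : j ∈ F
      · simpa [hF'] using (h.flip _ hF').2.2.2
      · simpa [hF'] using hstep

theorem isChain (h : Compatible R N s a b w v A B F) : (surgered s a b w A B F N).IsChain R := by
  refine (h.isChain_aux N le_rfl (fun h1 => ?_) (fun h1 => ?_)).1 <;>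
  · have := h.chord _ h1; omega

theorem head (h : Compatible R N s a b w v A B F) :
    ∃ l, surgered s a b w A B F N = s 0 :: l := by
  have hB : 0 ∉ B := fun hB => by have := h.detour 0 hB; omega
  have hF : 0 ∉ F := fun hF => by have := h.flip 0 hF; omega
  have h1 : 0 + 1 ∉ A := fun hF => by have := h.chord _ hF; omega
  have h2 : 0 + 2 ∉ A := fun hF => by have := h.chord _ hF; omega
  rw [surgered, List.range_succ_eq_map, List.flatMap_cons, piece_keep h1 h2 hB hF]
  exact ⟨_, rfl⟩

/-- The modified path determines the modifications. -/
theorem surgered_inj (h : Compatible R N s a b w v A B F) {A₁ B₁ F₁ A₂ B₂ F₂ : Finset ℕ}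
    (hA₁ : A₁ ⊆ A) (hB₁ : B₁ ⊆ B) (hF₁ : F₁ ⊆ F) (hA₂ : A₂ ⊆ A) (hB₂ : B₂ ⊆ B) (hF₂ : F₂ ⊆ F)
    (heq : surgered s a b w A₁ B₁ F₁ N = surgered s a b w A₂ B₂ F₂ N) :
    A₁ = A₂ ∧ B₁ = B₂ ∧ F₁ = F₂ := by
  classical
  have key (A' B' F' : Finset ℕ) (hA : A' ⊆ A) (hB : B' ⊆ B) (hF : F' ⊆ F) :
      A' = {n ∈ A | s (n - 1) ∉ surgered s a b w A' B' F' N} ∧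
      B' = {n ∈ B | a n ∈ surgered s a b w A' B' F' N} ∧
      F' = {n ∈ F | w n ∈ surgered s a b w A' B' F' N} := by
    have h' := h.mono hA hB hF
    have hBF : B' ∪ F' ⊆ B ∪ F := Finset.union_subset_union hB hF
    refine ⟨?_, ?_, ?_⟩
    · ext n
      rw [Finset.mem_filter, mem_surgered]
      constructor
      · intro hn
        refine ⟨hA hn, ?_⟩
        have hc := h'.chord n hn
        rintro ⟨k, hk, hx⟩
        rcases h'.mem_piece hx with ⟨h1, h2, -⟩ | ⟨h1, h2⟩
        · have := h.inj _ (by omega) _ hk h1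
          apply h2
          rwa [← this, Nat.sub_add_cancel (by omega)]
        · exact h.new k (hBF h1) (n - 1) (by omega) h2
      · rintro ⟨hnA, hn⟩
        by_contra hn'
        have hc := h.chord n hnA
        apply hn
        refine ⟨n - 1, by omega, ?_⟩
        rw [piece_keep]
        · simp
        · rwa [Nat.sub_add_cancel (by omega)]
        · intro h1
          have := h.sep' (Or.inl hnA) (Or.inl (hA h1)); omega
        · intro h1
          have := h.sep' (Or.inl hnA) (Or.inr (Or.inl (hB h1))); omega
        · intro h1
          have := h.sep' (Or.inl hnA) (Or.inr (Or.inr (hF h1))); omega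
    · ext n
      rw [Finset.mem_filter, mem_surgered]
      constructor
      · intro hn
        exact ⟨hB hn, n, (h'.detour n hn).2.1, by simp [h'.piece_detour hn]⟩
      · rintro ⟨hnB, k, hk, hx⟩
        have hnB' : n ∈ B ∪ F := Finset.mem_union_left _ hnB
        have hv := (h.detour_mem n hnB).1
        rcases h'.mem_piece hx with ⟨h1, -⟩ | ⟨h1, h2⟩
        · exact absurd (h1 ▸ hv) (h.new n hnB' k hk)
        · by_cases hkn : k = n
          · subst hkn
            rcases Finset.mem_union.1 h1 with h1 | h1
            · exact h1
            · exact absurd (hF h1) (h.notBF hnB)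
          · exact absurd hv (Finset.disjoint_left.1 (h.disj k (hBF h1) n hnB' hkn) h2)
    · ext n
      rw [Finset.mem_filter, mem_surgered]
      constructor
      · intro hn
        have := h'.flip n hn
        exact ⟨hF hn, n, by omega, by simp [h'.piece_flip hn]⟩
      · rintro ⟨hnF, k, hk, hx⟩
        have hnB' : n ∈ B ∪ F := Finset.mem_union_right _ hnF
        have hv := h.flip_mem n hnF
        rcases h'.mem_piece hx with ⟨h1, -⟩ | ⟨h1, h2⟩
        · exact absurd (h1 ▸ hv) (h.new n hnB' k hk)
        · by_cases hkn : k = n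
          · subst hkn
            rcases Finset.mem_union.1 h1 with h1 | h1
            · exact absurd hnF (h.notBF (hB h1))
            · exact h1
          · exact absurd hv (Finset.disjoint_left.1 (h.disj k (hBF h1) n hnB' hkn) h2)
  obtain ⟨a1, b1, c1⟩ := key A₁ B₁ F₁ hA₁ hB₁ hF₁
  obtain ⟨a2, b2, c2⟩ := key A₂ B₂ F₂ hA₂ hB₂ hF₂
  rw [heq] at a1 b1 c1
  exact ⟨a1.trans a2.symm, b1.trans b2.symm, c1.trans c2.symm⟩

/-- A finite set that contains every `R`-path without repetition of length `N` from `s 0` has at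
least `centralBinom m * 2 ^ #F` elements, as soon as there are at least `m` chords and `m` detours.
An `m`-element subset `W` of `m` chords and `m` detours encodes the use of the chords in `W` and of
the detours outside `W`, so that as many chords as detours are used and the length stays `N`. -/
theorem card_le (h : Compatible R N s a b w v A B F) {m : ℕ} (hA : m ≤ A.card) (hB : m ≤ B.card)
    (T : Finset (List V))
    (hT : ∀ l : List V, l.length = N + 1 → l.head? = some (s 0) → l.Nodup → l.IsChain R → l ∈ T) :
    m.centralBinom * 2 ^ F.card ≤ T.card := by
  obtain ⟨A₀, hA₀, hA₀c⟩ := Finset.exists_subset_card_eq hA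
  obtain ⟨B₀, hB₀, hB₀c⟩ := Finset.exists_subset_card_eq hB
  have hdisj : Disjoint A₀ B₀ :=
    Finset.disjoint_of_subset_left hA₀ (Finset.disjoint_of_subset_right hB₀ h.disjAB)
  have hcard : ((A₀ ∪ B₀).powersetCard m ×ˢ F.powerset).card = m.centralBinom * 2 ^ F.card := by
    rw [Finset.card_product, Finset.card_powersetCard, Finset.card_union_of_disjoint hdisj, hA₀c,
      hB₀c, Finset.card_powerset, Nat.centralBinom, two_mul]
  rw [← hcard]
  refine Finset.card_le_card_of_injOn
    (fun W => surgered s a b w (A₀ ∩ W.1) (B₀ \ W.1) W.2 N) ?_ ?_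
  · rintro ⟨W, F'⟩ hW
    simp only [Finset.coe_product, Set.mem_prod, Finset.mem_coe, Finset.mem_powersetCard,
      Finset.mem_powerset] at hW
    obtain ⟨⟨hW1, hW2⟩, hF'⟩ := hW
    have h' := h.mono (Finset.inter_subset_left.trans hA₀ : A₀ ∩ W ⊆ A)
      (Finset.sdiff_subset.trans hB₀ : B₀ \ W ⊆ B) hF'
    obtain ⟨l, hl⟩ := h'.head
    refine hT _ (h'.length_surgered ?_) (by simp [hl]) h'.nodup h'.isChain
    have e1 : W = (A₀ ∩ W) ∪ (B₀ ∩ W) := by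
      rw [← Finset.union_inter_distrib_right, Finset.inter_eq_right.2 hW1]
    have e2 : W.card = (A₀ ∩ W).card + (B₀ ∩ W).card := by
      conv_lhs => rw [e1]
      exact Finset.card_union_of_disjoint (Finset.disjoint_of_subset_left Finset.inter_subset_left
        (Finset.disjoint_of_subset_right Finset.inter_subset_left hdisj))
    have e3 := Finset.card_sdiff_add_card_inter B₀ W
    omega
  · rintro ⟨W₁, F₁⟩ h1 ⟨W₂, F₂⟩ h2 heq
    simp only [Finset.coe_product, Set.mem_prod, Finset.mem_coe, Finset.mem_powersetCard,
      Finset.mem_powerset] at h1 h2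
    obtain ⟨e1, e2, e3⟩ := h.surgered_inj (Finset.inter_subset_left.trans hA₀)
      (Finset.sdiff_subset.trans hB₀) h1.2 (Finset.inter_subset_left.trans hA₀)
      (Finset.sdiff_subset.trans hB₀) h2.2 heq
    refine Prod.ext ?_ e3
    ext x
    have := h1.1.1
    have := h2.1.1
    have e1x : x ∈ A₀ ∩ W₁ ↔ x ∈ A₀ ∩ W₂ := by rw [e1]
    have e2x : x ∈ B₀ \ W₁ ↔ x ∈ B₀ \ W₂ := by rw [e2]
    have i1 : x ∈ W₁ → x ∈ A₀ ∪ B₀ := fun hx => h1.1.1 hx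
    have i2 : x ∈ W₂ → x ∈ A₀ ∪ B₀ := fun hx => h2.1.1 hx
    simp only [Finset.mem_inter, Finset.mem_sdiff, Finset.mem_union] at e1x e2x i1 i2
    show x ∈ W₁ ↔ x ∈ W₂
    tauto

end Compatible

end Surgery

/-! ### Independent Bernoulli variables: monotonicity and concentration -/

section Bernoulli

variable {ι : Type*}

/-- The i.i.d. Bernoulli measure of parameter `p` on the configurations `ι → Bool`. -/
noncomputable def bernoulliPi (ι : Type*) (p : unitInterval) : Measure (ι → Bool) :=
  Measure.infinitePi fun _ => bernoulliMeasure true false p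

instance (p : unitInterval) : IsProbabilityMeasure (bernoulliPi ι p) := by
  unfold bernoulliPi; infer_instance

theorem bernoulliPi_real_open (p : unitInterval) (E : Finset ι) :
    (bernoulliPi ι p).real {ω | ∀ e ∈ E, ω e = true} = (p : ℝ) ^ E.card := by
  have h : {ω : ι → Bool | ∀ e ∈ E, ω e = true} = Set.pi E fun _ => {true} := by
    ext; simp
  have h1 : bernoulliMeasure true false p {true} = unitInterval.toNNReal p :=
    bernoulliMeasure_apply_of_mem_of_notMem p (measurableSet_singleton _) (by simp) (by simp)
  rw [h, Measure.real, bernoulliPi, Measure.infinitePi_pi _ fun _ _ => measurableSet_singleton _]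
  simp [h1]

theorem measurableSet_open (E : Finset ι) :
    MeasurableSet {ω : ι → Bool | ∀ e ∈ E, ω e = true} := by
  have h : {ω : ι → Bool | ∀ e ∈ E, ω e = true} = ⋂ e ∈ E, (fun ω => ω e) ⁻¹' {true} := by
    ext; simp
  rw [h]
  exact Finset.measurableSet_biInter _ fun e _ => measurable_pi_apply e (measurableSet_singleton _)

/-- All coordinates in `E` are open, but no set of the family `E' ν`, `ν ∈ C`, is entirely open. -/
def openAlone {κ : Type*} (E : Finset ι) (C : Finset κ) (E' : κ → Finset ι) : Set (ι → Bool) :=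
  {ω | (∀ e ∈ E, ω e = true) ∧ ∀ ν ∈ C, ¬ ∀ e ∈ E' ν, ω e = true}

theorem openAlone_eq {κ : Type*} (E : Finset ι) (C : Finset κ) (E' : κ → Finset ι) :
    openAlone E C E' = {ω | ∀ e ∈ E, ω e = true} \ ⋃ ν ∈ C, {ω | ∀ e ∈ E' ν, ω e = true} := by
  ext; simp [openAlone]

theorem measurableSet_openAlone {κ : Type*} (E : Finset ι) (C : Finset κ) (E' : κ → Finset ι) :
    MeasurableSet (openAlone E C E') := by
  rw [openAlone_eq]
  exact (measurableSet_open E).diff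
    (Finset.measurableSet_biUnion _ fun ν _ => measurableSet_open (E' ν))

/-- Union bound: if `E` is open and so is some `E' ν`, then all of `E ∪ E' ν` is open. -/
theorem le_bernoulliPi_real_openAlone [DecidableEq ι] {κ : Type*} (p : unitInterval)
    (E : Finset ι) (C : Finset κ) (E' : κ → Finset ι) :
    (p : ℝ) ^ E.card * (1 - ∑ ν ∈ C, (p : ℝ) ^ (E' ν \ E).card) ≤
      (bernoulliPi ι p).real (openAlone E C E') := by
  have h1 : {ω : ι → Bool | ∀ e ∈ E, ω e = true} ⊆
      openAlone E C E' ∪ ⋃ ν ∈ C, {ω | ∀ e ∈ E ∪ (E' ν \ E), ω e = true} := by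
    intro ω hω
    by_cases h : ∀ ν ∈ C, ¬ ∀ e ∈ E' ν, ω e = true
    · exact Or.inl ⟨hω, h⟩
    · push Not at h
      obtain ⟨ν, hν, h⟩ := h
      refine Or.inr (Set.mem_biUnion hν ?_)
      intro e he
      simp only [Finset.union_sdiff_self_eq_union, Finset.mem_union] at he
      exact he.elim (hω e) (h e)
  have h2 := (measureReal_mono (μ := bernoulliPi ι p) h1 (measure_ne_top _ _)).trans
    (measureReal_union_le _ _)
  have h3 := measureReal_biUnion_finset_le (μ := bernoulliPi ι p) C
    fun ν => {ω | ∀ e ∈ E ∪ (E' ν \ E), ω e = true}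
  rw [bernoulliPi_real_open] at h2
  simp_rw [bernoulliPi_real_open, Finset.card_union_of_disjoint Finset.disjoint_sdiff, pow_add,
    ← Finset.mul_sum] at h3
  linarith

/-- Increasing the parameter decreases the probability of a decreasing event: both measures are
images of i.i.d. uniform variables. -/
theorem bernoulliPi_mono {p q : unitInterval} (hpq : p ≤ q) {A : Set (ι → Bool)}
    (hA : MeasurableSet A) (hdec : ∀ ω ω' : ι → Bool, ω ≤ ω' → ω' ∈ A → ω ∈ A) :
    (bernoulliPi ι q).real A ≤ (bernoulliPi ι p).real A := by
  let f (r : unitInterval) (u : unitInterval) : Bool := decide (u ≤ r)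
  have hf (r : unitInterval) : Measurable (f r) := by
    refine measurable_to_bool ?_
    have : f r ⁻¹' {true} = Set.Iic r := by ext; simp [f]
    rw [this]
    exact measurableSet_Iic
  have hmap (r : unitInterval) :
      (volume : Measure unitInterval).map (f r) = bernoulliMeasure true false r := by
    refine Measure.ext_of_singleton fun x => ?_
    rw [Measure.map_apply (hf r) (measurableSet_singleton _)]
    cases x
    · rw [bernoulliMeasure_apply_of_notMem_of_mem r (measurableSet_singleton _) (by simp)
        (by simp)]
      have : f r ⁻¹' {false} = Set.Ioi r := by ext; simp [f]
      rw [this, unitInterval.volume_Ioi, ENNReal.ofReal]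
      congr 1
      ext
      simp only [Real.coe_toNNReal', sub_nonneg.2 r.2.2, sup_of_le_left]
      rfl
    · rw [bernoulliMeasure_apply_of_mem_of_notMem r (measurableSet_singleton _) (by simp)
        (by simp)]
      have : f r ⁻¹' {true} = Set.Iic r := by ext; simp [f]
      rw [this, unitInterval.volume_Iic, ENNReal.ofReal]
      congr 1
      ext
      simp only [Real.coe_toNNReal', r.2.1, sup_of_le_left]
      rfl
  have hm (r : unitInterval) : bernoulliPi ι r =
      (Measure.infinitePi fun _ : ι => (volume : Measure unitInterval)).map
        fun u i => f r (u i) := by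
    rw [Measure.infinitePi_map_pi (μ := fun _ : ι => (volume : Measure unitInterval))
      (f := fun _ => f r) fun _ => hf r, bernoulliPi]
    simp_rw [hmap]
  have hmeas (r : unitInterval) : Measurable fun (u : ι → unitInterval) i => f r (u i) :=
    measurable_pi_lambda _ fun i => (hf r).comp (measurable_pi_apply i)
  rw [hm, hm, map_measureReal_apply (hmeas q) hA, map_measureReal_apply (hmeas p) hA]
  refine measureReal_mono fun u hu => hdec _ _ (fun i => ?_) hu
  by_cases h : u i ≤ p
  · simp [f, h, h.trans hpq]
  · simp [f, h]

/-- Restrictions to disjoint sets of coordinates are independent. -/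
theorem iIndepFun_restrict {J : Type*} (p : unitInterval) (T : J → Finset ι)
    (hT : ∀ i j, i ≠ j → Disjoint (T i) (T j)) :
    iIndepFun (fun j (ω : ι → Bool) (e : T j) => ω e) (bernoulliPi ι p) := by
  let g : (Σ j, T j) → ι := fun x => x.2
  have hg : Function.Injective g := by
    rintro ⟨i, x⟩ ⟨j, y⟩ hxy
    have hxy : (x : ι) = y := hxy
    by_cases hij : i = j
    · subst hij
      rw [Subtype.ext hxy]
    · exact absurd (hxy ▸ y.2) (Finset.disjoint_left.1 (hT i j hij) x.2)
  rw [iIndepFun_iff_map_fun_eq_infinitePi_map (by fun_prop)]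
  have h1 := Measure.map_infinitePi_infinitePi_of_inj
    (P := fun _ : ι => bernoulliMeasure true false p) hg
  have h2 := Measure.infinitePi_map_piCurry
    (fun (j : J) (_ : T j) => bernoulliMeasure true false p)
  have h3 (j : J) : (bernoulliPi ι p).map (fun ω (e : T j) => ω e) =
      Measure.infinitePi fun _ : T j => bernoulliMeasure true false p :=
    Measure.map_infinitePi_infinitePi_of_inj
      (P := fun _ : ι => bernoulliMeasure true false p) Subtype.val_injective
  simp_rw [h3]
  rw [← h2, ← h1, Measure.map_map (by fun_prop) (by fun_prop)]
  rfl

/-- Concentration for events that can be coloured with finitely many colours such that two events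
of the same colour depend on disjoint sets of coordinates. -/
theorem concentration {I K : Type*} [Fintype K] [DecidableEq K] [Nonempty K] (p : unitInterval)
    (M : Finset I)
    (G : I → Set (ι → Bool)) (T : I → Finset ι) (c : I → K) (hG : ∀ i ∈ M, MeasurableSet (G i))
    (hT : ∀ i ∈ M, ∀ ω ω' : ι → Bool, (∀ e ∈ T i, ω e = ω' e) → ω ∈ G i → ω' ∈ G i)
    (hc : ∀ i ∈ M, ∀ j ∈ M, i ≠ j → c i = c j → Disjoint (T i) (T j))
    {t : ℝ} (ht : 0 < t) {n : ℝ} (hn : (M.card : ℝ) ≤ n) :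
    (bernoulliPi ι p).real {ω | ∑ i ∈ M, (G i).indicator 1 ω ≤
        ∑ i ∈ M, (bernoulliPi ι p).real (G i) - Fintype.card K * t} ≤
      Fintype.card K * Real.exp (-2 * t ^ 2 / n) := by
  classical
  set P := bernoulliPi ι p with hP
  let X (i : I) (ω : ι → Bool) : ℝ := P.real (G i) - (G i).indicator 1 ω
  have hcover : {ω | ∑ i ∈ M, (G i).indicator 1 ω ≤
        ∑ i ∈ M, P.real (G i) - Fintype.card K * t} ⊆
      ⋃ k ∈ (Finset.univ : Finset K), {ω | t ≤ ∑ i : {i ∈ M | c i = k}, X i ω} := by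
    intro ω hω
    by_contra hcon
    simp only [Finset.mem_univ, Set.iUnion_true, Set.mem_iUnion, Set.mem_ofPred_eq, not_exists,
      not_le] at hcon
    have h1 : ∑ i ∈ M, X i ω = ∑ k : K, ∑ i ∈ M with c i = k, X i ω :=
      (Finset.sum_fiberwise M c _).symm
    have h2 : ∑ k : K, ∑ i ∈ M with c i = k, X i ω < ∑ k : K, t := by
      refine Finset.sum_lt_sum_of_nonempty Finset.univ_nonempty fun k _ => ?_
      rw [← Finset.sum_coe_sort]
      exact hcon k
    simp only [Set.mem_ofPred_eq] at hω
    simp only [X, Finset.sum_sub_distrib] at h1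
    simp only [Finset.sum_const, Finset.card_univ, nsmul_eq_mul] at h2
    simp only [X, Finset.sum_sub_distrib] at h2
    linarith
  refine (measureReal_mono hcover (measure_ne_top _ _)).trans ((measureReal_biUnion_finset_le _ _).trans ?_)
  have hk (k : K) : P.real {ω | t ≤ ∑ i : {i ∈ M | c i = k}, X i ω} ≤
      Real.exp (-2 * t ^ 2 / n) := by
    set Mk : Finset I := {i ∈ M | c i = k} with hMk
    have hMkM (i : Mk) : (i : I) ∈ M := (Finset.mem_filter.1 i.2).1
    rcases Mk.eq_empty_or_nonempty with hemp | hne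
    · have : {ω : ι → Bool | t ≤ ∑ i : Mk, X i ω} = ∅ := by
        ext ω
        have : ∑ i : Mk, X i ω = 0 := by
          rw [Finset.sum_coe_sort Mk fun i => X i ω, hemp, Finset.sum_empty]
        simpa only [Set.mem_ofPred_eq, this, Set.mem_empty_iff_false, iff_false, not_le] using ht
      rw [this]
      simp only [measureReal_empty]
      positivity
    -- `X i` only depends on the coordinates in `T i`: `Y i` fills in the others with `false`.
    let Y (i : Mk) (y : T i → Bool) : ℝ := P.real (G i) -
      (G i).indicator 1 (fun e => if h : e ∈ T i then y ⟨e, h⟩ else false)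
    have hXY (i : Mk) : X i = Y i ∘ fun (ω : ι → Bool) (e : T i) => ω e := by
      funext ω
      have : ω ∈ G i ↔ (fun e => if h : e ∈ T i then ω e else false) ∈ G i :=
        ⟨hT i (hMkM i) _ _ fun e he => by simp [he], hT i (hMkM i) _ _ fun e he => by simp [he]⟩
      simp only [X, Y, Function.comp, Set.indicator, ← this, Pi.one_apply]
    have hind : iIndepFun (fun i : Mk => X i) P := by
      simp_rw [hXY]
      refine (iIndepFun_restrict p (fun i : Mk => T i) fun i j hij => ?_).comp Y
        fun i => measurable_of_finite _
      exact hc i (hMkM i) j (hMkM j) (fun h => hij (Subtype.ext h))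
        ((Finset.mem_filter.1 i.2).2.trans (Finset.mem_filter.1 j.2).2.symm)
    have hsub (i : Mk) : HasSubgaussianMGF (X i) (1 / 4) P := by
      have hm : Measurable fun ω => (G i).indicator (1 : (ι → Bool) → ℝ) ω :=
        measurable_one.indicator (hG i (hMkM i))
      have h1 := (hasSubgaussianMGF_of_mem_Icc (μ := P) (a := 0) (b := 1) hm.aemeasurable
        (Filter.Eventually.of_forall fun ω => by
          by_cases h : ω ∈ G i <;> simp [h])).neg
      have h2 : (‖(1 : ℝ) - 0‖₊ / 2) ^ 2 = (1 / 4 : NNReal) := by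
        rw [sub_zero, nnnorm_one, div_pow]; norm_num
      have h3 : P[fun ω => (G i).indicator (1 : (ι → Bool) → ℝ) ω] = P.real (G i) :=
        integral_indicator_one (hG i (hMkM i))
      rw [h2, h3] at h1
      convert h1 using 1
      funext ω
      simp [X]
    have h := HasSubgaussianMGF.measure_sum_ge_le_of_iIndepFun hind
      (s := Finset.univ) (c := fun _ => 1 / 4) (fun i _ => hsub i) ht.le
    refine h.trans (Real.exp_le_exp.2 ?_)
    have hcard : (0 : ℝ) < Mk.card := by exact_mod_cast hne.card_pos
    have hle : (Mk.card : ℝ) ≤ n := by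
      refine le_trans ?_ hn
      exact_mod_cast Finset.card_filter_le _ _
    simp only [Finset.sum_const, Finset.card_univ, Fintype.card_coe, nsmul_eq_mul]
    push_cast
    rw [neg_mul, neg_div, neg_div, neg_le_neg_iff, div_le_div_iff₀ (by linarith) (by positivity)]
    have := mul_le_mul_of_nonneg_left hle (sq_nonneg t)
    nlinarith
  calc _ ≤ ∑ k : K, Real.exp (-2 * t ^ 2 / n) := Finset.sum_le_sum fun k _ => hk k
    _ = _ := by simp

end Bernoulli

/-! ### The lattice and its self-avoiding paths -/

section Lattice

variable {d : ℕ}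

theorem l1dist_self (x : Fin d → ℤ) : l1dist x x = 0 := by simp [l1dist]

theorem l1dist_comm (x y : Fin d → ℤ) : l1dist x y = l1dist y x := by
  simp [l1dist, abs_sub_comm]

theorem l1dist_triangle (x y z : Fin d → ℤ) : l1dist x z ≤ l1dist x y + l1dist y z := by
  rw [l1dist, l1dist, l1dist, ← Finset.sum_add_distrib]
  exact Finset.sum_le_sum fun i _ => abs_sub_le _ _ _

theorem l1dist_eq_of_sub {x y x' y' : Fin d → ℤ} (h : x - y = x' - y') :
    l1dist x y = l1dist x' y' := by
  unfold l1dist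
  refine Finset.sum_congr rfl fun i _ => ?_
  have := congrFun h i
  simp only [Pi.sub_apply] at this
  rw [this]

theorem abs_sub_le_l1dist (x y : Fin d → ℤ) (i : Fin d) : |x i - y i| ≤ l1dist x y :=
  Finset.single_le_sum (f := fun i => |x i - y i|) (fun _ _ => abs_nonneg _) (Finset.mem_univ i)

/-- Neighbours in the lattice have coordinate sums of different parities. -/
theorem odd_sum_sub_sum {x y : Fin d → ℤ} (h : (lattice d).Adj x y) :
    Odd (∑ i, x i - ∑ i, y i) := by
  have h : ∑ i, |x i - y i| = 1 := h
  have h2 (a : ℤ) : Even (|a| - a) := by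
    rcases abs_choice a with h | h <;> rw [h]
    · simp
    · exact ⟨-a, by ring⟩
  have h1 : Even (∑ i, (|x i - y i| - (x i - y i))) :=
    Finset.even_sum _ fun i _ => h2 _
  rw [Finset.sum_sub_distrib, h, Finset.sum_sub_distrib] at h1
  obtain ⟨k, hk⟩ := h1
  exact ⟨-k, by omega⟩

/-- The `2d` signed directions of the lattice. -/
abbrev Dir (d : ℕ) : Type := Fin d × ℤˣ

/-- The unit vector in a signed direction. -/
def unitVec (e : Dir d) : Fin d → ℤ := Pi.single e.1 (e.2 : ℤ)

theorem card_dir (d : ℕ) : Fintype.card (Dir d) = 2 * d := by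
  simp [Dir, mul_comm]

theorem unitVec_injective : Function.Injective (unitVec (d := d)) := by
  rintro ⟨i, a⟩ ⟨j, b⟩ h
  have h1 := congrFun h i
  simp only [unitVec, Pi.single_eq_same] at h1
  by_cases hij : i = j
  · subst hij
    simp only [Pi.single_eq_same] at h1
    rw [Units.ext h1]
  · rw [Pi.single_eq_of_ne hij] at h1
    exact absurd h1 a.ne_zero

theorem adj_add_unitVec (x : Fin d → ℤ) (e : Dir d) : (lattice d).Adj x (x + unitVec e) := by
  show ∑ i, |x i - (x + unitVec e) i| = 1
  have (i : Fin d) : |x i - (x + unitVec e) i| = if i = e.1 then 1 else 0 := by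
    by_cases h : i = e.1
    · subst h
      rcases Int.units_eq_one_or e.2 with h | h <;> simp [unitVec, h]
    · simp [unitVec, h]
  rw [Finset.sum_congr rfl fun i _ => this i]
  simp

end Lattice

section Path

variable {d N : ℕ} {S : SiteSeq d N}

theorem site_zero (hS : S ∈ selfAvoiding d N) : site S 0 = 0 := hS.1

theorem site_eq {n : ℕ} (hn : n ≤ N) : site S n = S ⟨n, Nat.lt_succ_of_le hn⟩ := by
  unfold site
  congr 1
  ext
  simp [Fin.ofNat, Nat.mod_eq_of_lt (Nat.lt_succ_of_le hn)]

theorem site_adj (hS : S ∈ selfAvoiding d N) {n : ℕ} (hn : n < N) :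
    (lattice d).Adj (site S n) (site S (n + 1)) := by
  rw [site_eq hn.le, site_eq hn]
  exact hS.2.1 ⟨n, hn⟩

theorem site_adj_pred (hS : S ∈ selfAvoiding d N) {n : ℕ} (h1 : 1 ≤ n) (hn : n ≤ N) :
    (lattice d).Adj (site S (n - 1)) (site S n) := by
  have := site_adj hS (show n - 1 < N by omega)
  rwa [Nat.sub_add_cancel h1] at this

theorem site_inj (hS : S ∈ selfAvoiding d N) {m n : ℕ} (hm : m ≤ N) (hn : n ≤ N)
    (h : site S m = site S n) : m = n := by
  rw [site_eq hm, site_eq hn] at h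
  simpa using hS.2.2 h

theorem l1dist_site_add_le (hS : S ∈ selfAvoiding d N) (m k : ℕ) (h : m + k ≤ N) :
    l1dist (site S m) (site S (m + k)) ≤ k := by
  induction k with
  | zero => simp [l1dist_self]
  | succ k ih =>
    have h1 := l1dist_triangle (site S m) (site S (m + k)) (site S (m + (k + 1)))
    have h2 : l1dist (site S (m + k)) (site S (m + (k + 1))) = 1 := site_adj hS (by omega)
    have h3 := ih (by omega)
    push_cast
    omega

theorem l1dist_site_le (hS : S ∈ selfAvoiding d N) {m n k : ℕ} (hm : m ≤ N) (hn : n ≤ N)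
    (h1 : m ≤ n + k) (h2 : n ≤ m + k) : l1dist (site S m) (site S n) ≤ k := by
  rcases le_total m n with h | h
  · have := l1dist_site_add_le hS m (n - m) (by omega)
    rw [Nat.add_sub_cancel' h] at this
    omega
  · have := l1dist_site_add_le hS n (m - n) (by omega)
    rw [Nat.add_sub_cancel' h, l1dist_comm] at this
    omega

/-- No site of the path is within distance two of an isolated one, except at nearby times. -/
theorem near_of_isolated {m n : ℕ} (hn : n ∈ isolatedTimes S) (hm : m ≤ N)
    (h : l1dist (site S m) (site S n) ≤ 2) : m ≤ n + 2 ∧ n ≤ m + 2 := by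
  have := hn.2 m hm
  have h2 : ¬ 2 < |(m : ℤ) - n| := fun h3 => absurd (this h3) (by omega)
  rw [lt_abs] at h2
  omega

end Path

/-! ### Chords, flips and detours of a spine -/

section Surgeries

variable {d N : ℕ} {S : SiteSeq d N}

/-- The kinds of local modifications of a path: `Sum.inl false` is a chord, which cuts a U-turn
short; `Sum.inl true` is a flip, which exchanges two successive increments; `Sum.inr e` is a detour
of one edge in the direction `e`. -/
abbrev Kind (d : ℕ) : Type := Bool ⊕ Dir d

/-- A local modification: a time and a kind. -/
abbrev Surgery (d : ℕ) : Type := ℕ × Kind d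

/-- The site which replaces `S_n` when the increments `X_n` and `X_{n+1}` are exchanged. -/
def flipSite (S : SiteSeq d N) (n : ℕ) : Fin d → ℤ := site S (n - 1) + (site S (n + 1) - site S n)

/-- The sites off the path used by a local modification. -/
def newSites (S : SiteSeq d N) : Surgery d → Finset (Fin d → ℤ)
  | (_, .inl false) => ∅
  | (n, .inl true) => {flipSite S n}
  | (n, .inr e) => {site S (n - 1) + unitVec e, site S n + unitVec e}

/-- The unordered pairs of sites that a local modification adds to the path. -/
def newPairs (S : SiteSeq d N) : Surgery d → Finset (Sym2 (Fin d → ℤ))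
  | (n, .inl false) => {s(site S (n - 3), site S n)}
  | (n, .inl true) => {s(site S (n - 1), flipSite S n), s(flipSite S n, site S (n + 1))}
  | (n, .inr e) => {s(site S (n - 1), site S (n - 1) + unitVec e),
      s(site S (n - 1) + unitVec e, site S n + unitVec e), s(site S n + unitVec e, site S n)}

open Classical in
/-- The edges that a local modification adds to the path. -/
noncomputable def newEdges (S : SiteSeq d N) (μ : Surgery d) : Finset (lattice d).edgeSet :=
  (newPairs S μ).subtype (· ∈ (lattice d).edgeSet)

/-- The local modifications that the geometry of the path allows. Flips are used only next to an
isolated time, so that flips at distant times do not interfere. -/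
def Allowed (S : SiteSeq d N) : Surgery d → Prop
  | (n, .inl false) => n ∈ uTurns S
  | (n, .inl true) =>
    1 ≤ n ∧ n + 1 ≤ N ∧ n - 1 ∈ isolatedTimes S ∧ ∀ m ≤ N, flipSite S n ≠ site S m
  | (n, .inr e) => 1 ≤ n ∧ n ≤ N ∧
      ∀ m ≤ N, site S (n - 1) + unitVec e ≠ site S m ∧ site S n + unitVec e ≠ site S m

theorem Allowed.one_le {μ : Surgery d} (h : Allowed S μ) : 1 ≤ μ.1 := by
  obtain ⟨n, (_ | _) | e⟩ := μ
  · have h : 3 ≤ n := h.1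
    show 1 ≤ n
    omega
  · exact h.1
  · exact h.1

theorem Allowed.le {μ : Surgery d} (h : Allowed S μ) : μ.1 ≤ N := by
  obtain ⟨n, (_ | _) | e⟩ := μ
  · exact h.2.1
  · exact (Nat.le_succ _).trans h.2.1
  · exact h.2.1

theorem Allowed.newSites_ne {μ : Surgery d} (h : Allowed S μ) {v : Fin d → ℤ}
    (hv : v ∈ newSites S μ) {m : ℕ} (hm : m ≤ N) : v ≠ site S m := by
  obtain ⟨n, (_ | _) | e⟩ := μ
  · simp [newSites] at hv
  · simp only [newSites, Finset.mem_singleton] at hv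
    exact hv ▸ h.2.2.2 m hm
  · simp only [newSites, Finset.mem_insert, Finset.mem_singleton] at hv
    rcases hv with rfl | rfl
    · exact (h.2.2 m hm).1
    · exact (h.2.2 m hm).2

theorem adj_flipSite (hS : S ∈ selfAvoiding d N) {n : ℕ} (hn : n + 1 ≤ N) :
    (lattice d).Adj (site S (n - 1)) (flipSite S n) := by
  have h : l1dist (site S n) (site S (n + 1)) = 1 := site_adj hS hn
  show l1dist _ _ = 1
  rw [← h]
  exact l1dist_eq_of_sub (by simp [flipSite])

theorem flipSite_adj (hS : S ∈ selfAvoiding d N) {n : ℕ} (h1 : 1 ≤ n) (hn : n + 1 ≤ N) :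
    (lattice d).Adj (flipSite S n) (site S (n + 1)) := by
  have h : l1dist (site S (n - 1)) (site S n) = 1 := site_adj_pred hS h1 (by omega)
  show l1dist _ _ = 1
  rw [← h]
  exact l1dist_eq_of_sub (by simp only [flipSite]; abel)

theorem adj_add (hS : S ∈ selfAvoiding d N) {n : ℕ} (h1 : 1 ≤ n) (hn : n ≤ N) (u : Fin d → ℤ) :
    (lattice d).Adj (site S (n - 1) + u) (site S n + u) := by
  have h : l1dist (site S (n - 1)) (site S n) = 1 := site_adj_pred hS h1 hn
  show l1dist _ _ = 1
  rw [← h]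
  exact l1dist_eq_of_sub (by abel)

/-- Every pair of sites in `newPairs` is an edge of the lattice. -/
theorem Allowed.newPairs_edge (hS : S ∈ selfAvoiding d N) {μ : Surgery d} (h : Allowed S μ)
    {z : Sym2 (Fin d → ℤ)} (hz : z ∈ newPairs S μ) : z ∈ (lattice d).edgeSet := by
  obtain ⟨n, (_ | _) | e⟩ := μ
  · simp only [newPairs, Finset.mem_singleton] at hz
    subst hz
    exact h.2.2.symm
  · simp only [newPairs, Finset.mem_insert, Finset.mem_singleton] at hz
    rcases hz with rfl | rfl
    · exact adj_flipSite hS h.2.1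
    · exact flipSite_adj hS h.1 h.2.1
  · simp only [newPairs, Finset.mem_insert, Finset.mem_singleton] at hz
    rcases hz with rfl | rfl | rfl
    · exact adj_add_unitVec _ _
    · exact adj_add hS h.1 h.2.1 _
    · exact (adj_add_unitVec _ _).symm

theorem mem_newEdges {μ : Surgery d} {e : (lattice d).edgeSet} :
    e ∈ newEdges S μ ↔ (e : Sym2 (Fin d → ℤ)) ∈ newPairs S μ := by
  simp [newEdges]

theorem card_newEdges_le (n : ℕ) :
    (newEdges S (n, .inl false)).card ≤ 1 ∧ (newEdges S (n, .inl true)).card ≤ 2 ∧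
      ∀ e, (newEdges S (n, .inr e)).card ≤ 3 := by
  have h (μ : Surgery d) : (newEdges S μ).card ≤ (newPairs S μ).card := by
    classical
    rw [newEdges, Finset.card_subtype]
    exact Finset.card_filter_le _ _
  exact ⟨(h _).trans (by simp [newPairs]), (h _).trans Finset.card_le_two,
    fun e => (h _).trans Finset.card_le_three⟩

/-- If an edge from the path to a site off the path belongs to a local modification, then the latter
is a flip or a detour and the edge is one of its two outer edges. -/
theorem Allowed.pair_on_off (hS : S ∈ selfAvoiding d N) {μ : Surgery d} (h : Allowed S μ) {i : ℕ}
    (hi : i ≤ N) {x : Fin d → ℤ} (hx : ∀ m ≤ N, x ≠ site S m)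
    (hz : s(site S i, x) ∈ newPairs S μ) :
    (μ.2 = .inl true ∧ (i = μ.1 - 1 ∨ i = μ.1 + 1)) ∨
    ∃ e, μ.2 = .inr e ∧ ((i = μ.1 - 1 ∧ x = site S i + unitVec e) ∨
      (i = μ.1 ∧ x = site S i + unitVec e)) := by
  have hle := h.le
  have hne := fun v (hv : v ∈ newSites S μ) => h.newSites_ne hv hi
  obtain ⟨n, (_ | _) | e⟩ := μ
  · simp only [newPairs, Finset.mem_singleton, Sym2.eq_iff] at hz
    rcases hz with ⟨-, h1⟩ | ⟨-, h1⟩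
    · exact absurd h1 (hx n hle)
    · exact absurd h1 (hx (n - 3) (by simp only at hle; omega))
  · have h2 := h.2.1
    simp only [newSites, Finset.mem_singleton, forall_eq] at hne
    simp only [newPairs, Finset.mem_insert, Finset.mem_singleton, Sym2.eq_iff] at hz
    refine Or.inl ⟨rfl, ?_⟩
    rcases hz with (⟨h1, -⟩ | ⟨h1, -⟩) | (⟨h1, -⟩ | ⟨h1, -⟩)
    · exact Or.inl (site_inj hS hi (by omega) h1)
    · exact absurd h1.symm hne
    · exact absurd h1.symm hne
    · exact Or.inr (site_inj hS hi h2 h1)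
  · have h2 : n ≤ N := h.2.1
    simp only [newSites, Finset.mem_insert, Finset.mem_singleton, forall_eq_or_imp,
      forall_eq] at hne
    simp only [newPairs, Finset.mem_insert, Finset.mem_singleton, Sym2.eq_iff] at hz
    refine Or.inr ⟨e, rfl, ?_⟩
    rcases hz with (⟨h1, h3⟩ | ⟨h1, -⟩) | (⟨h1, -⟩ | ⟨h1, -⟩) | (⟨h1, -⟩ | ⟨h1, h3⟩)
    · exact Or.inl ⟨site_inj hS hi (by omega) h1, h1 ▸ h3⟩
    · exact absurd h1.symm hne.1
    · exact absurd h1.symm hne.1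
    · exact absurd h1.symm hne.2
    · exact absurd h1.symm hne.2
    · exact Or.inr ⟨site_inj hS hi h2 h1, h1 ▸ h3⟩

/-- If an edge between two sites off the path belongs to a local modification, then the latter is a
detour and the edge is its middle edge. -/
theorem Allowed.pair_off_off {μ : Surgery d} (h : Allowed S μ)
    {x y : Fin d → ℤ} (hx : ∀ m ≤ N, x ≠ site S m) (hy : ∀ m ≤ N, y ≠ site S m)
    (hz : s(x, y) ∈ newPairs S μ) :
    ∃ e, μ.2 = .inr e ∧
      ((x = site S (μ.1 - 1) + unitVec e ∧ y = site S μ.1 + unitVec e) ∨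
       (x = site S μ.1 + unitVec e ∧ y = site S (μ.1 - 1) + unitVec e)) := by
  have hle := h.le
  obtain ⟨n, (_ | _) | e⟩ := μ
  · simp only [newPairs, Finset.mem_singleton, Sym2.eq_iff] at hz
    rcases hz with ⟨-, h1⟩ | ⟨h1, -⟩
    · exact absurd h1 (hy n hle)
    · exact absurd h1 (hx n hle)
  · have h2 := h.2.1
    simp only [newPairs, Finset.mem_insert, Finset.mem_singleton, Sym2.eq_iff] at hz
    rcases hz with (⟨h1, -⟩ | ⟨-, h1⟩) | (⟨-, h1⟩ | ⟨h1, -⟩)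
    · exact absurd h1 (hx _ (by omega))
    · exact absurd h1 (hy _ (by omega))
    · exact absurd h1 (hy _ h2)
    · exact absurd h1 (hx _ h2)
  · have h2 : n ≤ N := h.2.1
    simp only [newPairs, Finset.mem_insert, Finset.mem_singleton, Sym2.eq_iff] at hz
    refine ⟨e, rfl, ?_⟩
    rcases hz with (⟨h1, -⟩ | ⟨-, h1⟩) | (h1 | h1) | (⟨-, h1⟩ | ⟨h1, -⟩)
    · exact absurd h1 (hx _ (by omega))
    · exact absurd h1 (hy _ (by omega))
    · exact Or.inl h1
    · exact Or.inr h1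
    · exact absurd h1 (hy _ h2)
    · exact absurd h1 (hx _ h2)

open Classical in
/-- A chord or a flip uses an edge that no other given local modification uses. -/
theorem Allowed.one_le_card_sdiff (hS : S ∈ selfAvoiding d N) {μ ν : Surgery d} (hμ : Allowed S μ)
    (hν : Allowed S ν) (hne : ν ≠ μ) {b : Bool} (hb : ν.2 = .inl b) :
    1 ≤ (newEdges S ν \ newEdges S μ).card := by
  suffices h : ∃ z ∈ newPairs S ν, z ∉ newPairs S μ by
    obtain ⟨z, h1, h2⟩ := h
    refine Finset.card_pos.2 ⟨⟨z, hν.newPairs_edge hS h1⟩, ?_⟩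
    simp [mem_newEdges, h1, h2]
  have hμ1 := hμ.one_le
  have hμN := hμ.le
  have hνN := hν.le
  by_contra hcon
  push Not at hcon
  obtain ⟨m, k⟩ := ν
  simp only at hb hνN
  subst hb
  cases b
  · have hz := hcon s(site S (m - 3), site S m) (by simp [newPairs])
    have hon (i : ℕ) (hi : i ≤ N) (v : Fin d → ℤ) (hv : v ∈ newSites S μ) : site S i ≠ v :=
      fun h => hμ.newSites_ne hv hi h.symm
    have h3 := hon (m - 3) (by omega)
    have h4 := hon m hνN
    obtain ⟨n, (_ | _) | e⟩ := μ
    · simp only [newPairs, Finset.mem_singleton, Sym2.eq_iff] at hz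
      have hm3 : 3 ≤ m := hν.1
      have hn3 : 3 ≤ n := hμ.1
      simp only at hμN
      rcases hz with ⟨-, h1⟩ | ⟨h1, h2⟩
      · exact hne (by rw [site_inj hS hνN hμN h1])
      · have := site_inj hS (by omega) hμN h1
        have := site_inj hS hνN (by omega) h2
        omega
    · simp only [newSites, Finset.mem_singleton, forall_eq] at h3 h4
      simp only [newPairs, Finset.mem_insert, Finset.mem_singleton, Sym2.eq_iff] at hz
      tauto
    · simp only [newSites, Finset.mem_insert, Finset.mem_singleton, forall_eq_or_imp,
        forall_eq] at h3 h4
      simp only [newPairs, Finset.mem_insert, Finset.mem_singleton, Sym2.eq_iff] at hz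
      tauto
  · obtain ⟨hm1, hm2, -, hw⟩ := hν
    have h1 := hμ.pair_on_off hS (show m - 1 ≤ N by omega) hw
      (hcon _ (by simp [newPairs]))
    have h2 := hμ.pair_on_off hS hm2 hw
      (hcon _ (by rw [Sym2.eq_swap]; simp [newPairs]))
    obtain ⟨n, k⟩ := μ
    simp only at h1 h2 hμ1
    rcases h1 with ⟨hk, h1⟩ | ⟨e, hk, h1⟩
    · rcases h2 with ⟨-, h2⟩ | ⟨e, hk', -⟩
      · have : m = n := by omega
        exact hne (by rw [this, hk])
      · rw [hk] at hk'; cases hk'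
    · rcases h2 with ⟨hk', -⟩ | ⟨e', -, h2⟩
      · rw [hk] at hk'; cases hk'
      · omega

open Classical in
/-- A detour uses at least two edges that another given local modification does not use. -/
theorem Allowed.two_le_card_sdiff (hS : S ∈ selfAvoiding d N) {μ ν : Surgery d} (hμ : Allowed S μ)
    (hν : Allowed S ν) (hne : ν ≠ μ) {f : Dir d} (hf : ν.2 = .inr f) :
    2 ≤ (newEdges S ν \ newEdges S μ).card := by
  obtain ⟨m, k⟩ := ν
  simp only at hf
  subst hf
  have hm1 : 1 ≤ m := hν.1
  have hmN : m ≤ N := hν.2.1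
  have hn1 := hμ.one_le
  have hnN := hμ.le
  set x := site S (m - 1) + unitVec f with hx
  set y := site S m + unitVec f with hy
  have hxoff : ∀ j ≤ N, x ≠ site S j := fun j hj => (hν.2.2 j hj).1
  have hyoff : ∀ j ≤ N, y ≠ site S j := fun j hj => (hν.2.2 j hj).2
  have hxy : x ≠ y := fun h => by
    have := site_inj hS (by omega) hmN (add_right_cancel h)
    omega
  have key1 (h : s(site S (m - 1), x) ∈ newPairs S μ) := hμ.pair_on_off hS (by omega) hxoff h
  have key2 (h : s(x, y) ∈ newPairs S μ) := hμ.pair_off_off hxoff hyoff h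
  have key3 (h : s(y, site S m) ∈ newPairs S μ) :=
    hμ.pair_on_off hS hmN hyoff (Sym2.eq_swap (a := y) ▸ h)
  have e1 : s(site S (m - 1), x) ∈ newPairs S (m, .inr f) := by simp [newPairs, x]
  have e2 : s(x, y) ∈ newPairs S (m, .inr f) := by simp [newPairs, x, y]
  have e3 : s(y, site S m) ∈ newPairs S (m, .inr f) := by simp [newPairs, y]
  have n12 : s(site S (m - 1), x) ≠ s(x, y) := by
    rw [ne_eq, Sym2.eq_iff]
    rintro (⟨h, -⟩ | ⟨h, -⟩)
    · exact hxoff _ (by omega) h.symm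
    · exact hyoff _ (by omega) h.symm
  have n13 : s(site S (m - 1), x) ≠ s(y, site S m) := by
    rw [ne_eq, Sym2.eq_iff]
    rintro (⟨h, -⟩ | ⟨-, h⟩)
    · exact hyoff _ (by omega) h.symm
    · exact hxy h
  have n23 : s(x, y) ≠ s(y, site S m) := by
    rw [ne_eq, Sym2.eq_iff]
    rintro (⟨h, -⟩ | ⟨h, -⟩)
    · exact hxy h
    · exact hxoff _ hmN h
  have suff (z z' : Sym2 (Fin d → ℤ)) (hz : z ∈ newPairs S (m, .inr f))
      (hz' : z' ∈ newPairs S (m, .inr f)) (hzz : z ≠ z') (hzμ : z ∉ newPairs S μ)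
      (hzμ' : z' ∉ newPairs S μ) :
      2 ≤ (newEdges S (m, .inr f) \ newEdges S μ).card := by
    refine Finset.one_lt_card.2 ⟨⟨z, hν.newPairs_edge hS hz⟩, ?_, ⟨z', hν.newPairs_edge hS hz'⟩,
      ?_, fun h => hzz (congrArg Subtype.val h)⟩ <;> simp [mem_newEdges, *]
  obtain ⟨n, k⟩ := μ
  simp only at key1 key2 key3 hn1 hnN
  -- No two of the three edges of the detour can belong to the other modification.
  have no12 (h1 : s(site S (m - 1), x) ∈ newPairs S (n, k)) : s(x, y) ∉ newPairs S (n, k) := by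
    intro h2
    obtain ⟨e, rfl, hm⟩ := key2 h2
    rcases key1 h1 with ⟨h, -⟩ | ⟨e', he, hi⟩
    · cases h
    cases he
    have hef : unitVec f = unitVec e := by
      rcases hi with ⟨-, h1⟩ | ⟨-, h1⟩ <;> exact add_left_cancel h1
    have hef' := unitVec_injective hef
    subst hef'
    simp only [x, y, add_left_inj] at hm
    rcases hi with ⟨h1, -⟩ | ⟨h1, -⟩
    · have : m = n := by omega
      exact hne (by rw [this])
    · rcases hm with ⟨h2, -⟩ | ⟨-, h2⟩
      · have := site_inj hS (by omega) (by omega) h2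
        omega
      · have := site_inj hS (by omega) (by omega) h2
        omega
  have no13 (h1 : s(site S (m - 1), x) ∈ newPairs S (n, k)) :
      s(y, site S m) ∉ newPairs S (n, k) := by
    intro h3
    rcases key1 h1 with ⟨rfl, hi⟩ | ⟨e, rfl, hi⟩
    · rcases key3 h3 with ⟨-, hj⟩ | ⟨e', he, -⟩
      · omega
      · cases he
    · rcases key3 h3 with ⟨he, -⟩ | ⟨e', he, hj⟩
      · cases he
      cases he
      have hef : unitVec f = unitVec e := by
        rcases hi with ⟨-, h1⟩ | ⟨-, h1⟩ <;> exact add_left_cancel h1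
      have : m = n := by omega
      exact hne (by rw [this, unitVec_injective hef])
  have no23 (h2 : s(x, y) ∈ newPairs S (n, k)) : s(y, site S m) ∉ newPairs S (n, k) := by
    intro h3
    obtain ⟨e, rfl, hm⟩ := key2 h2
    rcases key3 h3 with ⟨h, -⟩ | ⟨e', he, hj⟩
    · cases h
    cases he
    have hef : unitVec f = unitVec e := by
      rcases hj with ⟨-, h3⟩ | ⟨-, h3⟩ <;> exact add_left_cancel h3
    have hef' := unitVec_injective hef
    subst hef'
    simp only [x, y, add_left_inj] at hm
    rcases hj with ⟨h3, -⟩ | ⟨h3, -⟩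
    · rcases hm with ⟨h2, h4⟩ | ⟨h2, h4⟩
      · have := site_inj hS (by omega) (by omega) h4
        omega
      · have := site_inj hS (by omega) (by omega) h2
        omega
    · exact hne (by rw [h3])
  by_cases h1 : s(site S (m - 1), x) ∈ newPairs S (n, k)
  · exact suff _ _ e2 e3 n23 (no12 h1) (no13 h1)
  by_cases h2 : s(x, y) ∈ newPairs S (n, k)
  · exact suff _ _ e1 e3 n13 h1 (no23 h2)
  · exact suff _ _ e1 e2 n12 h1 h2

end Surgeries

/-! ### Conflicts between modifications and good modifications -/

section Conflicts

variable {d N : ℕ} {S : SiteSeq d N}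

open Classical in
/-- The finitely many local modifications allowed along a path. -/
noncomputable def surgeries (S : SiteSeq d N) : Finset (Surgery d) :=
  (Finset.range (N + 1) ×ˢ Finset.univ).filter (Allowed S)

theorem mem_surgeries {μ : Surgery d} : μ ∈ surgeries S ↔ Allowed S μ := by
  classical
  simp only [surgeries, Finset.mem_filter, Finset.mem_product, Finset.mem_range, Finset.mem_univ,
    and_true, and_iff_right_iff_imp]
  exact fun h => Nat.lt_succ_of_le h.le

open Classical in
/-- The allowed modifications that cannot be used together with `μ`: those at a nearby time, and
those that visit a common site off the path. -/
noncomputable def conflicts (S : SiteSeq d N) (μ : Surgery d) : Finset (Surgery d) :=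
  (surgeries S).filter fun ν => ν ≠ μ ∧
    ((ν.1 ≤ μ.1 + 5 ∧ μ.1 ≤ ν.1 + 5) ∨ ¬ Disjoint (newSites S μ) (newSites S ν))

/-- The event that a modification is open and that no conflicting one is. -/
def goodEvent (S : SiteSeq d N) (μ : Surgery d) : Set (Env d) :=
  openAlone (newEdges S μ) (conflicts S μ) (newEdges S)

theorem mem_conflicts {μ ν : Surgery d} : ν ∈ conflicts S μ ↔ Allowed S ν ∧ ν ≠ μ ∧
    ((ν.1 ≤ μ.1 + 5 ∧ μ.1 ≤ ν.1 + 5) ∨ ∃ v ∈ newSites S μ, v ∈ newSites S ν) := by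
  classical
  simp only [conflicts, Finset.mem_filter, mem_surgeries, Finset.not_disjoint_iff]

theorem Allowed.exists_near_newSites (hS : S ∈ selfAvoiding d N) {μ : Surgery d} (h : Allowed S μ)
    {v : Fin d → ℤ} (hv : v ∈ newSites S μ) :
    ∃ j ≤ N, j ≤ μ.1 ∧ μ.1 ≤ j + 1 ∧ l1dist (site S j) v = 1 := by
  have hN := h.le
  have h1 := h.one_le
  obtain ⟨n, (_ | _) | e⟩ := μ
  · simp [newSites] at hv
  · simp only [newSites, Finset.mem_singleton] at hv
    simp only at hN h1 ⊢
    exact ⟨n - 1, by omega, by omega, by omega, hv ▸ adj_flipSite hS h.2.1⟩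
  · simp only [newSites, Finset.mem_insert, Finset.mem_singleton] at hv
    simp only at hN h1 ⊢
    rcases hv with rfl | rfl
    · exact ⟨n - 1, by omega, by omega, by omega, adj_add_unitVec _ _⟩
    · exact ⟨n, by omega, by omega, by omega, adj_add_unitVec _ _⟩

/-- Flips only conflict with modifications at nearby times. -/
theorem flip_conflict_near (hS : S ∈ selfAvoiding d N) {μ : Surgery d} (h : Allowed S μ) {m : ℕ}
    (hm : (m, .inl true) ∈ conflicts S μ) : m ≤ μ.1 + 5 ∧ μ.1 ≤ m + 5 := by
  rw [mem_conflicts] at hm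
  obtain ⟨⟨h1, h2, hiso, -⟩, -, hm | ⟨v, hv, hv'⟩⟩ := hm
  · exact hm
  · simp only [newSites, Finset.mem_singleton] at hv'
    subst hv'
    obtain ⟨j, hj, hj1, hj2, hjv⟩ := h.exists_near_newSites hS hv
    have h3 : l1dist (site S (m - 1)) (flipSite S m) = 1 := adj_flipSite hS h2
    have h4 := l1dist_triangle (site S j) (flipSite S m) (site S (m - 1))
    rw [l1dist_comm (flipSite S m)] at h4
    have := near_of_isolated hiso hj (by omega)
    omega

theorem card_newSites_le (μ : Surgery d) : (newSites S μ).card ≤ 2 := by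
  obtain ⟨n, (_ | _) | e⟩ := μ
  · simp [newSites]
  · simp [newSites]
  · exact Finset.card_le_two

open Classical in
/-- A modification conflicts with few modifications of each kind. -/
theorem card_conflicts_le (hS : S ∈ selfAvoiding d N) {μ : Surgery d} (h : Allowed S μ)
    (k : Kind d) : ((conflicts S μ).filter (·.2 = k)).card ≤ 15 := by
  have hcard : ((conflicts S μ).filter (·.2 = k)).card =
      (((conflicts S μ).filter (·.2 = k)).image Prod.fst).card := by
    rw [Finset.card_image_of_injOn]
    intro x hx y hy hxy
    simp only [Finset.coe_filter, Set.mem_ofPred_eq] at hx hy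
    exact Prod.ext hxy (hx.2.trans hy.2.symm)
  rw [hcard]
  set near := Finset.Icc (μ.1 - 5) (μ.1 + 5) with hnear
  have hnc : near.card ≤ 11 := by
    rw [hnear, Nat.card_Icc]; omega
  have hmem (m : ℕ) (hm : m ∈ ((conflicts S μ).filter (·.2 = k)).image Prod.fst) :
      (m, k) ∈ conflicts S μ := by
    simp only [Finset.mem_image, Finset.mem_filter] at hm
    obtain ⟨⟨m', k'⟩, ⟨h1, h2⟩, h3⟩ := hm
    simp only at h2 h3
    rwa [← h2, ← h3]
  have hclose (m : ℕ) (h1 : m ≤ μ.1 + 5 ∧ μ.1 ≤ m + 5) : m ∈ near := by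
    rw [hnear, Finset.mem_Icc]; omega
  obtain (_ | _) | f := k
  · refine (Finset.card_le_card (t := near) fun m hm => ?_).trans (by omega)
    obtain ⟨-, -, h1 | ⟨v, -, hv⟩⟩ := mem_conflicts.1 (hmem m hm)
    · exact hclose m h1
    · simp [newSites] at hv
  · refine (Finset.card_le_card (t := near) fun m hm => ?_).trans (by omega)
    exact hclose m (flip_conflict_near hS h (hmem m hm))
  · -- A detour in direction `f` visits a site `v` only if its edge starts or ends at `v - f`.
    set P := (Finset.range (N + 1)).filter fun j => site S j + unitVec f ∈ newSites S μ with hP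
    have hPc : P.card ≤ 2 := by
      refine (Finset.card_le_card_of_injOn (fun j => site S j + unitVec f) ?_ ?_).trans
        (card_newSites_le (S := S) μ)
      · intro j hj
        exact (Finset.mem_filter.1 hj).2
      · intro i hi j hj hij
        simp only [hP, Finset.coe_filter, Set.mem_ofPred_eq, Finset.mem_range,
          Nat.lt_succ_iff] at hi hj
        exact site_inj hS hi.1 hj.1 (add_right_cancel hij)
    refine (Finset.card_le_card (t := near ∪ (P ∪ P.image (· + 1))) fun m hm => ?_).trans ?_
    · obtain ⟨hal, -, h1 | ⟨v, hv, hv'⟩⟩ := mem_conflicts.1 (hmem m hm)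
      · exact Finset.mem_union_left _ (hclose m h1)
      · have h1 := hal.one_le
        have h2 := hal.le
        simp only at h1 h2
        refine Finset.mem_union_right _ ?_
        simp only [newSites, Finset.mem_insert, Finset.mem_singleton] at hv'
        rcases hv' with rfl | rfl
        · refine Finset.mem_union_right _ (Finset.mem_image.2 ⟨m - 1, ?_, by omega⟩)
          exact Finset.mem_filter.2 ⟨Finset.mem_range.2 (by omega), hv⟩
        · exact Finset.mem_union_left _ (Finset.mem_filter.2 ⟨Finset.mem_range.2 (by omega), hv⟩)
    · have h1 := Finset.card_union_le near (P ∪ P.image (· + 1))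
      have h2 := Finset.card_union_le P (P.image (· + 1))
      have h3 : (P.image (· + 1)).card ≤ P.card := Finset.card_image_le
      omega

open Classical in
/-- The conditional probability that some conflicting modification is open is `O(p)`: each of the
`2d` kinds of detours contributes `p ^ 2`, chords and flips contribute `p`. -/
theorem sum_conflicts_le (hS : S ∈ selfAvoiding d N) {μ : Surgery d} (h : Allowed S μ)
    {p : ℝ} (hp0 : 0 ≤ p) (hp1 : p ≤ 1) :
    ∑ ν ∈ conflicts S μ, p ^ (newEdges S ν \ newEdges S μ).card ≤
      15 * (2 * p + 2 * d * p ^ 2) := by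
  let wt : Kind d → ℝ := Sum.elim (fun _ => p) fun _ => p ^ 2
  have h1 (k : Kind d) : ∑ ν ∈ conflicts S μ with ν.2 = k,
      p ^ (newEdges S ν \ newEdges S μ).card ≤ 15 * wt k := by
    have hwt : 0 ≤ wt k := by
      rcases k with k | k
      · exact hp0
      · exact sq_nonneg p
    calc _ ≤ ∑ ν ∈ conflicts S μ with ν.2 = k, wt k := by
          refine Finset.sum_le_sum fun ν hν => ?_
          obtain ⟨hν, hk⟩ := Finset.mem_filter.1 hν
          obtain ⟨hal, hne, -⟩ := mem_conflicts.1 hν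
          rcases k with k | k
          · calc _ ≤ p ^ 1 :=
                  pow_le_pow_of_le_one hp0 hp1 (h.one_le_card_sdiff hS hal hne hk)
              _ = p := pow_one p
          · exact pow_le_pow_of_le_one hp0 hp1 (h.two_le_card_sdiff hS hal hne hk)
      _ = ((conflicts S μ).filter (·.2 = k)).card * wt k := by simp
      _ ≤ 15 * wt k := by
          refine mul_le_mul_of_nonneg_right ?_ hwt
          exact_mod_cast card_conflicts_le hS h k
  rw [← Finset.sum_fiberwise (conflicts S μ) Prod.snd]
  refine (Finset.sum_le_sum fun k _ => h1 k).trans (le_of_eq ?_)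
  rw [← Finset.mul_sum, Fintype.sum_sum_type]
  simp [wt, mul_comm]

/-- The probability that a modification is good is of the order of the probability that it is
open. -/
theorem le_goodEvent (hS : S ∈ selfAvoiding d N) {μ : Surgery d} (h : Allowed S μ)
    {p : unitInterval} (hp : 2 * d * (p : ℝ) = 1) (hp45 : 45 * (p : ℝ) ≤ 1) {j : ℕ}
    (hj : (newEdges S μ).card ≤ j) :
    (p : ℝ) ^ j * (1 - 45 * p) ≤ (bernoulliPi _ p).real (goodEvent S μ) := by
  classical
  refine le_trans ?_ (le_bernoulliPi_real_openAlone p (newEdges S μ) (conflicts S μ) (newEdges S))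
  have h1 := sum_conflicts_le hS h p.2.1 p.2.2
  have h2 : 15 * (2 * (p : ℝ) + 2 * d * (p : ℝ) ^ 2) = 45 * p := by
    rw [pow_two, ← mul_assoc, hp]; ring
  rw [h2] at h1
  exact mul_le_mul (pow_le_pow_of_le_one p.2.1 p.2.2 hj) (by linarith) (by linarith)
    (pow_nonneg p.2.1 _)

open Classical in
/-- The edges on which `goodEvent` depends. -/
noncomputable def support (S : SiteSeq d N) (μ : Surgery d) : Finset (lattice d).edgeSet :=
  newEdges S μ ∪ (conflicts S μ).biUnion (newEdges S)

theorem goodEvent_congr (μ : Surgery d) {ω ω' : Env d} (h : ∀ e ∈ support S μ, ω e = ω' e)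
    (hω : ω ∈ goodEvent S μ) : ω' ∈ goodEvent S μ := by
  classical
  refine ⟨fun e he => ?_, fun ν hν hcon => hω.2 ν hν fun e he => ?_⟩
  · rw [← h e (Finset.mem_union_left _ he)]
    exact hω.1 e he
  · rw [h e (Finset.mem_union_right _ (Finset.mem_biUnion.2 ⟨ν, hν, he⟩))]
    exact hcon e he

theorem Allowed.l1dist_newSites_le (hS : S ∈ selfAvoiding d N) {μ : Surgery d} (h : Allowed S μ)
    {v : Fin d → ℤ} (hv : v ∈ newSites S μ) : l1dist v (site S μ.1) ≤ 2 := by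
  obtain ⟨j, hj, hj1, hj2, hjv⟩ := h.exists_near_newSites hS hv
  have h3 := l1dist_site_le hS (k := 1) hj h.le (by omega) (by omega)
  have h4 := l1dist_triangle v (site S j) (site S μ.1)
  rw [l1dist_comm v (site S j)] at h4
  push_cast at h3
  omega

theorem Allowed.l1dist_newPairs_le (hS : S ∈ selfAvoiding d N) {μ : Surgery d} (h : Allowed S μ)
    {z : Sym2 (Fin d → ℤ)} (hz : z ∈ newPairs S μ) {x : Fin d → ℤ} (hx : x ∈ z) :
    l1dist x (site S μ.1) ≤ 2 := by
  have hN := h.le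
  have h1 := h.one_le
  have hnew (v : Fin d → ℤ) (hv : v ∈ newSites S μ) : l1dist v (site S μ.1) ≤ 2 :=
    h.l1dist_newSites_le hS hv
  have hpred : l1dist (site S (μ.1 - 1)) (site S μ.1) ≤ 2 :=
    l1dist_site_le hS (k := 2) (by omega) hN (by omega) (by omega)
  have hself : l1dist (site S μ.1) (site S μ.1) ≤ 2 := by rw [l1dist_self]; omega
  obtain ⟨n, (_ | _) | e⟩ := μ
  · have hc : l1dist (site S n) (site S (n - 3)) = 1 := h.2.2
    simp only [newPairs, Finset.mem_singleton] at hz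
    subst hz
    rcases Sym2.mem_iff.1 hx with rfl | rfl
    · rw [l1dist_comm]; simp only; omega
    · exact hself
  · have h2 : n + 1 ≤ N := h.2.1
    have hsucc : l1dist (site S (n + 1)) (site S n) ≤ 2 :=
      l1dist_site_le hS (k := 2) h2 hN (by omega) (by omega)
    have hw := hnew (flipSite S n) (by simp [newSites])
    simp only [newPairs, Finset.mem_insert, Finset.mem_singleton] at hz
    rcases hz with rfl | rfl <;> rcases Sym2.mem_iff.1 hx with rfl | rfl <;> assumption
  · have ha := hnew (site S (n - 1) + unitVec e) (by simp [newSites])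
    have hb := hnew (site S n + unitVec e) (by simp [newSites])
    simp only [newPairs, Finset.mem_insert, Finset.mem_singleton] at hz
    rcases hz with rfl | rfl | rfl <;> rcases Sym2.mem_iff.1 hx with rfl | rfl <;> assumption

theorem Allowed.l1dist_support_le (hS : S ∈ selfAvoiding d N) {μ : Surgery d} (h : Allowed S μ)
    {e : (lattice d).edgeSet} (he : e ∈ support S μ) {x : Fin d → ℤ}
    (hx : x ∈ (e : Sym2 (Fin d → ℤ))) : l1dist x (site S μ.1) ≤ 7 := by
  classical
  simp only [support, Finset.mem_union, Finset.mem_biUnion] at he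
  rcases he with he | ⟨ν, hν, he⟩
  · have := h.l1dist_newPairs_le hS (mem_newEdges.1 he) hx
    omega
  · obtain ⟨hal, -, hnear⟩ := mem_conflicts.1 hν
    have h1 := hal.l1dist_newPairs_le hS (mem_newEdges.1 he) hx
    have h2 : l1dist (site S ν.1) (site S μ.1) ≤ 5 := by
      rcases hnear with hnear | ⟨v, hv, hv'⟩
      · exact l1dist_site_le hS (k := 5) hal.le h.le hnear.1 hnear.2
      · have h3 := h.l1dist_newSites_le hS hv
        have h4 := hal.l1dist_newSites_le hS hv'
        have h5 := l1dist_triangle (site S ν.1) v (site S μ.1)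
        rw [l1dist_comm _ v] at h5
        omega
    have h3 := l1dist_triangle x (site S ν.1) (site S μ.1)
    omega

/-- The colour of a modification: its position modulo `15` and its kind. -/
def colour (S : SiteSeq d N) (μ : Surgery d) : (Fin d → ZMod 15) × Kind d :=
  (fun i => (site S μ.1 i : ZMod 15), μ.2)

/-- The edges of the support are within distance `7` of the position of the modification, hence two
positions with intersecting supports are at distance at most `14`; if they agree modulo `15`, they
coincide. -/
theorem support_disjoint_of_colour_eq (hS : S ∈ selfAvoiding d N) {μ ν : Surgery d}
    (hμ : Allowed S μ) (hν : Allowed S ν) (hne : μ ≠ ν) (hc : colour S μ = colour S ν) :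
    Disjoint (support S μ) (support S ν) := by
  rw [Finset.disjoint_left]
  intro e h1 h2
  obtain ⟨x, hx⟩ : ∃ x, x ∈ (e : Sym2 (Fin d → ℤ)) := by
    induction (e : Sym2 (Fin d → ℤ)) with
    | _ x y => exact ⟨x, Sym2.mem_mk_left x y⟩
  have h3 := hμ.l1dist_support_le hS h1 hx
  have h4 := hν.l1dist_support_le hS h2 hx
  have h5 := l1dist_triangle (site S μ.1) x (site S ν.1)
  rw [l1dist_comm _ x] at h5
  obtain ⟨hc1, hc2⟩ := Prod.ext_iff.1 hc
  refine hne (Prod.ext (site_inj hS hμ.le hν.le ?_) hc2)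
  funext i
  have h6 := abs_sub_le_l1dist (site S μ.1) (site S ν.1) i
  have h7 : (site S μ.1 i : ZMod 15) = site S ν.1 i := congrFun hc1 i
  rw [ZMod.intCast_eq_intCast_iff_dvd_sub] at h7
  have h8 := abs_le.1 (h6.trans (by omega : _ ≤ (14 : ℤ)))
  push_cast at h7
  omega

theorem card_surgeries_le : (surgeries S).card ≤ (N + 1) * (2 * d + 2) := by
  classical
  refine (Finset.card_filter_le _ _).trans (le_of_eq ?_)
  rw [Finset.card_product, Finset.card_range, Finset.card_univ, Fintype.card_sum, card_dir]
  simp [add_comm]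

open Classical in
/-- The number of good modifications of a given class is rarely much smaller than its mean. -/
theorem good_concentration (hS : S ∈ selfAvoiding d N) (p : unitInterval) {M : Finset (Surgery d)}
    (hM : M ⊆ surgeries S) {t : ℝ} (ht : 0 < t) :
    (bernoulliPi _ p).real {ω : Env d | (({μ ∈ M | ω ∈ goodEvent S μ}.card : ℕ) : ℝ) ≤
        ∑ μ ∈ M, (bernoulliPi _ p).real (goodEvent S μ) -
          Fintype.card ((Fin d → ZMod 15) × Kind d) * t} ≤
      Fintype.card ((Fin d → ZMod 15) × Kind d) *
        Real.exp (-2 * t ^ 2 / ((N + 1) * (2 * d + 2))) := by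
  have hal (μ) (hμ : μ ∈ M) : Allowed S μ := mem_surgeries.1 (hM hμ)
  have h := concentration p M (goodEvent S) (support S) (colour S)
    (fun μ _ => measurableSet_openAlone _ _ _)
    (fun μ _ ω ω' h hω => goodEvent_congr μ h hω)
    (fun μ hμ ν hν hne hc => support_disjoint_of_colour_eq hS (hal μ hμ) (hal ν hν) hne hc) ht
    (n := (N + 1) * (2 * d + 2))
    (by exact_mod_cast (Finset.card_le_card hM).trans card_surgeries_le)
  convert h using 5 with ω
  simp [Set.indicator_apply]

end Conflicts

/-! ### Open paths obtained from good modifications -/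

section SpineCount

variable {d N : ℕ} {S : SiteSeq d N}

theorem finite_selfAvoiding (d N : ℕ) : (selfAvoiding d N).Finite := by
  refine (Set.finite_Icc (fun _ _ => -(N : ℤ) : SiteSeq d N) (fun _ _ => (N : ℤ))).subset ?_
  intro S hS
  have h (n : Fin (N + 1)) (i : Fin d) : |S n i| ≤ N := by
    have h1 := l1dist_site_le hS (m := 0) (n := n) (k := N) (by omega) (by omega) (by omega)
      (by omega)
    have h2 := abs_sub_le_l1dist (site S 0) (site S n) i
    rw [site_zero hS, site_eq (by omega : (n : ℕ) ≤ N)] at h2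
    rw [site_zero hS, site_eq (by omega : (n : ℕ) ≤ N)] at h1
    simp only [Pi.zero_apply, zero_sub, abs_neg, Fin.eta] at h1 h2
    omega
  exact ⟨fun n i => (abs_le.1 (h n i)).1, fun n i => (abs_le.1 (h n i)).2⟩

/-- The relation "joined by an edge that is open for the environment with spine `S`". -/
def OpenStep (S : SiteSeq d N) (ω : Env d) (x y : Fin d → ℤ) : Prop :=
  ∃ h : (lattice d).Adj x y, spineEnv S ω ⟨s(x, y), h⟩ = true

theorem openStep_of_open {ω : Env d} {x y : Fin d → ℤ} (h : (lattice d).Adj x y)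
    (hω : ω ⟨s(x, y), h⟩ = true) : OpenStep S ω x y :=
  ⟨h, by simp [spineEnv, hω]⟩

theorem openStep_site (hS : S ∈ selfAvoiding d N) (ω : Env d) {n : ℕ} (hn : n < N) :
    OpenStep S ω (site S n) (site S (n + 1)) := by
  refine ⟨site_adj hS hn, ?_⟩
  have : (⟨s(site S n, site S (n + 1)), site_adj hS hn⟩ : (lattice d).edgeSet) ∈ pathEdges S := by
    refine ⟨⟨n, hn⟩, ?_⟩
    simp only [site_eq hn.le, site_eq (Nat.succ_le_of_lt hn)]
    rfl
  simp [spineEnv, this]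

open Classical in
/-- Self-avoiding open paths, seen as lists of sites. -/
theorem exists_path_lists (S : SiteSeq d N) (ω : Env d) :
    ∃ T : Finset (List (Fin d → ℤ)), T.card ≤ spineZ S ω ∧
      ∀ l : List (Fin d → ℤ), l.length = N + 1 → l.head? = some 0 → l.Nodup →
        l.IsChain (OpenStep S ω) → l ∈ T := by
  have hfin : {S' ∈ selfAvoiding d N | IsOpenPath (spineEnv S ω) S'}.Finite :=
    (finite_selfAvoiding d N).subset fun _ h => h.1
  refine ⟨hfin.toFinset.image List.ofFn, ?_, ?_⟩
  · rw [spineZ, Z, Set.ncard_eq_toFinset_card _ hfin]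
    exact Finset.card_image_le
  · intro l hl h0 hnd hch
    obtain ⟨S', rfl⟩ : ∃ S' : SiteSeq d N, l = List.ofFn S' := by
      refine ⟨fun i => l.get (i.cast hl.symm), ?_⟩
      refine List.ext_get (by simp [hl]) fun n h1 h2 => ?_
      simp [-List.ofFn_succ]
    rw [List.nodup_ofFn] at hnd
    rw [List.isChain_iff_getElem] at hch
    have hstep (n : Fin N) : OpenStep S ω (S' n.castSucc) (S' n.succ) := by
      have := hch n (by simp)
      simp only [List.getElem_ofFn] at this
      exact this
    refine Finset.mem_image_of_mem _ (hfin.mem_toFinset.2 ⟨⟨?_, fun n => (hstep n).1, hnd⟩, ?_⟩)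
    · simpa using h0
    · rintro ⟨e, he⟩ ⟨n, rfl⟩
      exact (hstep n).2

theorem mem_newPairs_open {ω : Env d} {μ : Surgery d} (hg : ω ∈ goodEvent S μ)
    {x y : Fin d → ℤ} (h : (lattice d).Adj x y) (hz : s(x, y) ∈ newPairs S μ) :
    OpenStep S ω x y :=
  openStep_of_open h (hg.1 ⟨s(x, y), h⟩ (mem_newEdges.2 hz))

theorem not_conflict_of_good {ω : Env d} {μ ν : Surgery d} (hμ : ω ∈ goodEvent S μ)
    (hν : ω ∈ goodEvent S ν) : ν ∉ conflicts S μ :=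
  fun h => hμ.2 ν h hν.1

open Classical in
/-- The allowed chords. -/
noncomputable def chords (S : SiteSeq d N) : Finset (Surgery d) :=
  (surgeries S).filter fun μ => μ.2 = .inl false

open Classical in
/-- The allowed flips. -/
noncomputable def flips (S : SiteSeq d N) : Finset (Surgery d) :=
  (surgeries S).filter fun μ => μ.2 = .inl true

open Classical in
/-- The allowed detours. -/
noncomputable def detours (S : SiteSeq d N) : Finset (Surgery d) :=
  (surgeries S).filter fun μ => ∃ e, μ.2 = .inr e

open Classical in
/-- Good modifications do not conflict, hence they can be combined at will, and as many chords as
detours leave the length unchanged. -/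
theorem le_spineZ (hS : S ∈ selfAvoiding d N) (ω : Env d) {m f : ℕ}
    (hc : m ≤ {μ ∈ chords S | ω ∈ goodEvent S μ}.card)
    (hd : m ≤ {μ ∈ detours S | ω ∈ goodEvent S μ}.card)
    (hf : f ≤ {μ ∈ flips S | ω ∈ goodEvent S μ}.card) :
    m.centralBinom * 2 ^ f ≤ spineZ S ω := by
  set Γ := (surgeries S).filter fun μ => ω ∈ goodEvent S μ with hΓ
  have hal {μ} (h : μ ∈ Γ) : Allowed S μ := mem_surgeries.1 (Finset.mem_filter.1 h).1
  have hgood {μ} (h : μ ∈ Γ) : ω ∈ goodEvent S μ := (Finset.mem_filter.1 h).2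
  have hconf {μ ν} (hμ : μ ∈ Γ) (hν : ν ∈ Γ) (hne : ν ≠ μ) :
      ¬ (ν.1 ≤ μ.1 + 5 ∧ μ.1 ≤ ν.1 + 5) ∧ Disjoint (newSites S μ) (newSites S ν) := by
    have h := not_conflict_of_good (hgood hμ) (hgood hν)
    rw [mem_conflicts] at h
    rw [Finset.disjoint_left]
    push Not at h
    have h := h (hal hν) hne
    exact ⟨fun h1 => by have := h.1 h1.1; omega, fun v hv => h.2 v hv⟩
  have htime {μ ν} (hμ : μ ∈ Γ) (hν : ν ∈ Γ) (h : ν.1 = μ.1) : ν = μ := by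
    by_contra hne
    exact (hconf hμ hν hne).1 (by omega)
  -- The kind of the unique good modification at time `n`; an arbitrary kind if there is none.
  let κ (n : ℕ) : Kind d := if h : ∃ k, (n, k) ∈ Γ then h.choose else .inl false
  have hκ {μ} (hμ : μ ∈ Γ) : κ μ.1 = μ.2 := by
    have h : ∃ k, (μ.1, k) ∈ Γ := ⟨μ.2, hμ⟩
    have h1 : (μ.1, κ μ.1) ∈ Γ := by
      simp only [κ, dif_pos h]
      exact h.choose_spec
    exact congrArg Prod.snd (htime hμ h1 rfl)
  let A := {μ ∈ chords S | ω ∈ goodEvent S μ}.image Prod.fst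
  let B := {μ ∈ detours S | ω ∈ goodEvent S μ}.image Prod.fst
  let F := {μ ∈ flips S | ω ∈ goodEvent S μ}.image Prod.fst
  have hA {n} : n ∈ A ↔ (n, .inl false) ∈ Γ := by
    constructor
    · intro h
      obtain ⟨⟨n', k⟩, hg, rfl⟩ := Finset.mem_image.1 h
      obtain ⟨h1, h2⟩ := Finset.mem_filter.1 hg
      obtain ⟨h3, rfl⟩ := Finset.mem_filter.1 h1
      exact Finset.mem_filter.2 ⟨h3, h2⟩
    · intro h
      obtain ⟨h1, h2⟩ := Finset.mem_filter.1 h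
      exact Finset.mem_image.2
        ⟨_, Finset.mem_filter.2 ⟨Finset.mem_filter.2 ⟨h1, rfl⟩, h2⟩, rfl⟩
  have hF {n} : n ∈ F ↔ (n, .inl true) ∈ Γ := by
    constructor
    · intro h
      obtain ⟨⟨n', k⟩, hg, rfl⟩ := Finset.mem_image.1 h
      obtain ⟨h1, h2⟩ := Finset.mem_filter.1 hg
      obtain ⟨h3, rfl⟩ := Finset.mem_filter.1 h1
      exact Finset.mem_filter.2 ⟨h3, h2⟩
    · intro h
      obtain ⟨h1, h2⟩ := Finset.mem_filter.1 h
      exact Finset.mem_image.2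
        ⟨_, Finset.mem_filter.2 ⟨Finset.mem_filter.2 ⟨h1, rfl⟩, h2⟩, rfl⟩
  have hB {n} : n ∈ B ↔ ∃ e, (n, .inr e) ∈ Γ := by
    constructor
    · intro h
      obtain ⟨⟨n', k⟩, hg, rfl⟩ := Finset.mem_image.1 h
      obtain ⟨h1, h2⟩ := Finset.mem_filter.1 hg
      obtain ⟨h3, e, rfl⟩ := Finset.mem_filter.1 h1
      exact ⟨e, Finset.mem_filter.2 ⟨h3, h2⟩⟩
    · rintro ⟨e, h⟩
      obtain ⟨h1, h2⟩ := Finset.mem_filter.1 h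
      exact Finset.mem_image.2
        ⟨_, Finset.mem_filter.2 ⟨Finset.mem_filter.2 ⟨h1, e, rfl⟩, h2⟩, rfl⟩
  have hcard (M : Finset (Surgery d)) (hM : M ⊆ surgeries S) :
      ({μ ∈ M | ω ∈ goodEvent S μ}.image Prod.fst).card = {μ ∈ M | ω ∈ goodEvent S μ}.card := by
    refine Finset.card_image_of_injOn fun μ hμ ν hν h => ?_
    have hsub : {μ ∈ M | ω ∈ goodEvent S μ} ⊆ Γ := Finset.filter_subset_filter _ hM
    exact htime (hsub hν) (hsub hμ) h
  let a (n : ℕ) : Fin d → ℤ := Sum.elim (fun _ => 0) (fun e => site S (n - 1) + unitVec e) (κ n)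
  let b (n : ℕ) : Fin d → ℤ := Sum.elim (fun _ => 0) (fun e => site S n + unitVec e) (κ n)
  have hany {n} (h : n ∈ A ∪ B ∪ F) : ∃ k, (n, k) ∈ Γ := by
    simp only [Finset.mem_union] at h
    rcases h with (h | h) | h
    · exact ⟨_, hA.1 h⟩
    · obtain ⟨e, h⟩ := hB.1 h; exact ⟨_, h⟩
    · exact ⟨_, hF.1 h⟩
  have hBF {n} (h : n ∈ B ∪ F) : (n, κ n) ∈ Γ := by
    obtain ⟨k, hk⟩ := hany (n := n) (by simp only [Finset.mem_union] at h ⊢; tauto)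
    have := hκ hk
    simp only at this
    rwa [this]
  have hcompat : Compatible (OpenStep S ω) N (site S) a b (flipSite S)
      (fun n => newSites S (n, κ n)) A B F := by
    refine ⟨fun n hn => openStep_site hS ω hn, fun m hm n hn h => site_inj hS hm hn h,
      ?_, ?_, ?_, ?_, ?_, ?_, ?_, ?_, ?_, ?_, ?_⟩
    · intro n hn
      have hn := hA.1 hn
      have h := hal hn
      refine ⟨h.1, h.2.1, mem_newPairs_open (hgood hn) h.2.2.symm (by simp [newPairs])⟩
    · intro n hn
      obtain ⟨e, hn⟩ := hB.1 hn
      have hk : κ n = .inr e := hκ hn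
      have h := hal hn
      simp only [a, b, hk, Sum.elim_inr]
      exact ⟨h.1, h.2.1,
        mem_newPairs_open (hgood hn) (adj_add_unitVec _ _) (by simp [newPairs]),
        mem_newPairs_open (hgood hn) (adj_add hS h.1 h.2.1 _) (by simp [newPairs]),
        mem_newPairs_open (hgood hn) (adj_add_unitVec _ _).symm (by simp [newPairs])⟩
    · intro n hn
      obtain ⟨e, hn⟩ := hB.1 hn
      have hk : κ n = .inr e := hκ hn
      have h := hal hn
      have h1 : 1 ≤ n := h.1
      have h2 : n ≤ N := h.2.1
      simp only [a, b, hk, Sum.elim_inr, newSites, Finset.mem_insert, Finset.mem_singleton,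
        true_or, or_true, true_and]
      intro hab
      have := site_inj hS (by omega) h2 (add_right_cancel hab)
      omega
    · intro n hn
      have hn := hF.1 hn
      have h := hal hn
      exact ⟨h.1, h.2.1,
        mem_newPairs_open (hgood hn) (adj_flipSite hS h.2.1) (by simp [newPairs]),
        mem_newPairs_open (hgood hn) (flipSite_adj hS h.1 h.2.1) (by simp [newPairs])⟩
    · intro n hn
      have hk : κ n = .inl true := hκ (hF.1 hn)
      simp [hk, newSites]
    · intro n hn k hk hmem
      exact (hal (hBF hn)).newSites_ne hmem hk rfl
    · intro m hm n hn hmn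
      exact (hconf (hBF hm) (hBF hn) fun h => hmn (congrArg Prod.fst h).symm).2
    · intro m hm n hn hmn
      obtain ⟨k, hk⟩ := hany hm
      obtain ⟨k', hk'⟩ := hany hn
      have := (hconf hk hk' fun h => hmn.ne (congrArg Prod.fst h).symm).1
      simp only at this
      omega
    · rw [Finset.disjoint_left]
      intro n h1 h2
      obtain ⟨e, h2⟩ := hB.1 h2
      cases congrArg Prod.snd (htime (hA.1 h1) h2 rfl)
    · rw [Finset.disjoint_left]
      intro n h1 h2
      cases congrArg Prod.snd (htime (hA.1 h1) (hF.1 h2) rfl)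
    · rw [Finset.disjoint_left]
      intro n h1 h2
      obtain ⟨e, h1⟩ := hB.1 h1
      cases congrArg Prod.snd (htime h1 (hF.1 h2) rfl)
  obtain ⟨T, hT, hT'⟩ := exists_path_lists S ω
  have hAc : A.card = _ := hcard (chords S) (Finset.filter_subset _ _)
  have hBc : B.card = _ := hcard (detours S) (Finset.filter_subset _ _)
  have hFc : F.card = _ := hcard (flips S) (Finset.filter_subset _ _)
  have h := hcompat.card_le (m := m) (hAc ▸ hc) (hBc ▸ hd) T (by rwa [site_zero hS])
  rw [hFc] at h
  exact (Nat.mul_le_mul_left _ (Nat.pow_le_pow_right two_pos hf)).trans (h.trans hT)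

theorem one_le_spineZ (hS : S ∈ selfAvoiding d N) (ω : Env d) : 1 ≤ spineZ S ω := by
  classical
  simpa using le_spineZ hS ω (m := 0) (f := 0) (Nat.zero_le _) (Nat.zero_le _) (Nat.zero_le _)

theorem spineZ_mono (S : SiteSeq d N) {ω ω' : Env d} (h : ω ≤ ω') : spineZ S ω ≤ spineZ S ω' := by
  refine Set.ncard_le_ncard ?_ ((finite_selfAvoiding d N).subset fun _ h => h.1)
  rintro S' ⟨h1, h2⟩
  refine ⟨h1, fun e he => ?_⟩
  have h3 := h2 e he
  unfold spineEnv at h3 ⊢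
  split_ifs at h3 ⊢
  · rfl
  · have := h e
    rw [h3] at this
    exact top_le_iff.1 this

theorem countable_pathEdges (S : SiteSeq d N) : (pathEdges S).Countable := by
  have : (pathEdges S) ⊆
      ⋃ n : Fin N, {e | (e : Sym2 (Fin d → ℤ)) = s(S n.castSucc, S n.succ)} := by
    rintro e ⟨n, hn⟩
    exact Set.mem_iUnion.2 ⟨n, hn⟩
  refine (Set.countable_iUnion fun n => Set.Subsingleton.countable ?_).mono this
  intro e he e' he'
  exact Subtype.ext (he.trans he'.symm)

theorem measurableSet_spineZ_le (S : SiteSeq d N) (x : ℝ) :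
    MeasurableSet {ω : Env d | (spineZ S ω : ℝ) ≤ x} := by
  classical
  have hopen (S' : SiteSeq d N) : MeasurableSet {ω : Env d | IsOpenPath (spineEnv S ω) S'} := by
    have : {ω : Env d | IsOpenPath (spineEnv S ω) S'} =
        ⋂ e ∈ pathEdges S', {ω | spineEnv S ω e = true} := by
      ext; simp [IsOpenPath]
    rw [this]
    refine MeasurableSet.biInter (countable_pathEdges S') fun e _ => ?_
    by_cases he : e ∈ pathEdges S
    · simp [spineEnv, he]
    · simp only [spineEnv, he, if_false]
      exact (measurable_pi_apply (X := fun _ => Bool) e) (measurableSet_singleton true)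
  have hsum (ω : Env d) : (spineZ S ω : ℝ) = ∑ S' ∈ (finite_selfAvoiding d N).toFinset,
      {ω : Env d | IsOpenPath (spineEnv S ω) S'}.indicator 1 ω := by
    have : {S' ∈ selfAvoiding d N | IsOpenPath (spineEnv S ω) S'} =
        ((finite_selfAvoiding d N).toFinset.filter fun S' => IsOpenPath (spineEnv S ω) S' :
          Finset _) := by
      ext; simp
    rw [spineZ, Z, this, Set.ncard_coe_finset]
    simp [Set.indicator_apply]
  simp_rw [hsum]
  exact measurableSet_le (Finset.measurable_sum _ fun S' _ =>
    measurable_one.indicator (hopen S')) measurable_const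

end SpineCount

/-! ### Counting the allowed modifications -/

section Counting

variable {d N : ℕ} {S : SiteSeq d N}

theorem ncard_uTurns_le (S : SiteSeq d N) : (uTurns S).ncard ≤ (chords S).card := by
  classical
  have h : uTurns S ⊆ ((chords S).image Prod.fst : Finset ℕ) := by
    intro n hn
    refine Finset.mem_coe.2 (Finset.mem_image.2 ⟨(n, .inl false), ?_, rfl⟩)
    exact Finset.mem_filter.2 ⟨mem_surgeries.2 hn, rfl⟩
  have h1 := Set.ncard_le_ncard h (Finset.finite_toSet _)
  rw [Set.ncard_coe_finset] at h1
  exact h1.trans Finset.card_image_le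

theorem finite_isolatedTimes (S : SiteSeq d N) : (isolatedTimes S).Finite :=
  (Set.finite_le_nat N).subset fun _ h => h.1

/-- A flip is possible after an isolated time, except near a straight piece or a U-turn. -/
theorem allowed_flip (hS : S ∈ selfAvoiding d N) {m : ℕ} (hm : m ∈ isolatedTimes S)
    (hmN : m + 2 ≤ N - 1) (hT : m + 2 ∉ straightTimes S) (hU : m + 2 ∉ uTurns S) :
    Allowed S (m + 1, .inl true) := by
  have hw : flipSite S (m + 1) = site S m + (site S (m + 2) - site S (m + 1)) := by
    simp [flipSite]
  refine ⟨by omega, by omega, by simpa using hm, fun j hj hwj => ?_⟩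
  have hadj : (lattice d).Adj (site S m) (flipSite S (m + 1)) := by
    simpa using adj_flipSite hS (show m + 1 + 1 ≤ N by omega)
  have h1 : l1dist (site S j) (site S m) = 1 := by
    rw [← hwj, l1dist_comm]; exact hadj
  have hnear := near_of_isolated hm hj (by omega)
  rw [hw] at hwj
  obtain rfl | rfl | rfl | rfl | rfl : j = m ∨ j = m + 1 ∨ j = m + 2 ∨ m = j + 1 ∨ m = j + 2 := by
    omega
  · have h2 : site S (j + 2) = site S (j + 1) := by
      simpa [sub_eq_zero] using hwj
    have := site_inj hS (by omega) (by omega) h2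
    omega
  · refine hT ⟨by omega, hmN, ?_⟩
    simp only [increment, Nat.add_sub_cancel, show m + 2 - 1 = m + 1 from rfl]
    exact eq_sub_of_add_eq' hwj
  · have h2 : site S m = site S (m + 1) := by
      rw [← sub_eq_zero]
      have := sub_eq_zero.2 hwj
      rw [← this]; abel
    have := site_inj hS (by omega) (by omega) h2
    omega
  · refine hU ⟨by omega, by omega, ?_⟩
    have h2 : l1dist (site S (j + 1)) (site S (j + 1 + 1)) = 1 := site_adj hS (by omega)
    show l1dist _ _ = 1
    rw [← h2, show j + 1 + 2 - 3 = j by omega, l1dist_comm]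
    refine l1dist_eq_of_sub ?_
    rw [← hwj]; abel
  · -- Two steps of the path, followed by the step back, cannot be closed: parity.
    have o1 := odd_sum_sub_sum (site_adj hS (show j < N by omega))
    have o2 := odd_sum_sub_sum (site_adj hS (show j + 1 < N by omega))
    have o3 := odd_sum_sub_sum (show (lattice d).Adj (site S j) (site S (j + 2)) from h1)
    simp only [add_assoc, one_add_one_eq_two] at o2
    rw [Int.odd_iff] at o1 o2 o3
    omega

theorem ncard_isolatedTimes_le (hS : S ∈ selfAvoiding d N) :
    (isolatedTimes S).ncard ≤
      (flips S).card + (straightTimes S).ncard + (uTurns S).ncard + 3 := by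
  classical
  have hT : (straightTimes S).Finite := (Set.finite_le_nat (N - 1)).subset fun _ h => h.2.1
  have hU : (uTurns S).Finite := (Set.finite_le_nat N).subset fun _ h => h.2.1
  have hsub : isolatedTimes S ⊆ (((((flips S).image Prod.fst).image (· - 1)) ∪
      (hT.toFinset.image (· - 2)) ∪ (hU.toFinset.image (· - 2)) ∪ {N - 2, N - 1, N} :
        Finset ℕ) : Set ℕ) := by
    intro m hm
    rw [Finset.mem_coe]
    have hmN := hm.1
    by_cases h1 : m + 2 ≤ N - 1
    · by_cases h2 : m + 2 ∈ straightTimes S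
      · refine Finset.mem_union_left _ (Finset.mem_union_left _ (Finset.mem_union_right _ ?_))
        exact Finset.mem_image.2 ⟨m + 2, hT.mem_toFinset.2 h2, rfl⟩
      by_cases h3 : m + 2 ∈ uTurns S
      · refine Finset.mem_union_left _ (Finset.mem_union_right _ ?_)
        exact Finset.mem_image.2 ⟨m + 2, hU.mem_toFinset.2 h3, rfl⟩
      · refine Finset.mem_union_left _ (Finset.mem_union_left _ (Finset.mem_union_left _ ?_))
        refine Finset.mem_image.2 ⟨m + 1, Finset.mem_image.2 ⟨(m + 1, .inl true), ?_, rfl⟩, rfl⟩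
        exact Finset.mem_filter.2 ⟨mem_surgeries.2 (allowed_flip hS hm h1 h2 h3), rfl⟩
    · refine Finset.mem_union_right _ ?_
      simp only [Finset.mem_insert, Finset.mem_singleton]
      omega
  have h := Set.ncard_le_ncard hsub (Finset.finite_toSet _)
  rw [Set.ncard_coe_finset] at h
  have h1 := Finset.card_union_le ((((flips S).image Prod.fst).image (· - 1)) ∪
      (hT.toFinset.image (· - 2)) ∪ (hU.toFinset.image (· - 2))) {N - 2, N - 1, N}
  have h2 := Finset.card_union_le ((((flips S).image Prod.fst).image (· - 1)) ∪
      (hT.toFinset.image (· - 2))) (hU.toFinset.image (· - 2))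
  have h3 := Finset.card_union_le (((flips S).image Prod.fst).image (· - 1))
      (hT.toFinset.image (· - 2))
  have h4 : (((flips S).image Prod.fst).image (· - 1)).card ≤ (flips S).card :=
    Finset.card_image_le.trans Finset.card_image_le
  have h5 : (hT.toFinset.image (· - 2)).card ≤ (straightTimes S).ncard := by
    rw [Set.ncard_eq_toFinset_card _ hT]; exact Finset.card_image_le
  have h6 : (hU.toFinset.image (· - 2)).card ≤ (uTurns S).ncard := by
    rw [Set.ncard_eq_toFinset_card _ hU]; exact Finset.card_image_le
  have h7 : ({N - 2, N - 1, N} : Finset ℕ).card ≤ 3 := Finset.card_le_three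
  omega

open Classical in
/-- All but ten directions are available for a detour that arrives at an isolated time. -/
theorem card_detour_dirs (hS : S ∈ selfAvoiding d N) {n : ℕ} (hn : n ∈ isolatedTimes S)
    (h1 : 1 ≤ n) :
    2 * d - 10 ≤ (Finset.univ.filter fun e : Dir d => Allowed S (n, .inr e)).card := by
  have hnN : n ≤ N := hn.1
  set bad := (Finset.Icc (n - 2) (n + 2)).biUnion fun j =>
    (Finset.univ.filter fun e : Dir d => unitVec e = site S j - site S (n - 1)) ∪
    (Finset.univ.filter fun e : Dir d => unitVec e = site S j - site S n) with hbad
  have hone (x : Fin d → ℤ) : (Finset.univ.filter fun e : Dir d => unitVec e = x).card ≤ 1 := by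
    refine Finset.card_le_one.2 fun e he e' he' => unitVec_injective ?_
    rw [(Finset.mem_filter.1 he).2, (Finset.mem_filter.1 he').2]
  have hbc : bad.card ≤ 10 := by
    refine Finset.card_biUnion_le.trans ((Finset.sum_le_card_nsmul _ _ 2 fun j _ => ?_).trans ?_)
    · refine (Finset.card_union_le _ _).trans ?_
      have := hone (site S j - site S (n - 1))
      have := hone (site S j - site S n)
      omega
    · rw [Nat.card_Icc, smul_eq_mul]; omega
  have hcover : (Finset.univ : Finset (Dir d)) ⊆
      (Finset.univ.filter fun e : Dir d => Allowed S (n, .inr e)) ∪ bad := by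
    intro e _
    by_cases he : Allowed S (n, .inr e)
    · exact Finset.mem_union_left _ (Finset.mem_filter.2 ⟨Finset.mem_univ _, he⟩)
    · refine Finset.mem_union_right _ ?_
      simp only [Allowed, not_and] at he
      have he := he h1 hnN
      push Not at he
      obtain ⟨j, hj, hej⟩ := he
      have hd1 : l1dist (site S (n - 1)) (site S n) = 1 := site_adj_pred hS h1 hnN
      have hmem (h : l1dist (site S j) (site S n) ≤ 2) : j ∈ Finset.Icc (n - 2) (n + 2) := by
        have := near_of_isolated hn hj h
        rw [Finset.mem_Icc]; omega
      by_cases h : site S (n - 1) + unitVec e = site S j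
      · have h2 : l1dist (site S (n - 1)) (site S j) = 1 := h ▸ adj_add_unitVec _ _
        have h3 := l1dist_triangle (site S j) (site S (n - 1)) (site S n)
        rw [l1dist_comm (site S j) (site S (n - 1))] at h3
        refine Finset.mem_biUnion.2 ⟨j, hmem (by omega), Finset.mem_union_left _ ?_⟩
        exact Finset.mem_filter.2 ⟨Finset.mem_univ _, by rw [← h]; abel⟩
      · have h' := hej h
        have h2 : l1dist (site S n) (site S j) = 1 := h' ▸ adj_add_unitVec _ _
        rw [l1dist_comm] at h2
        refine Finset.mem_biUnion.2 ⟨j, hmem (by omega), Finset.mem_union_right _ ?_⟩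
        exact Finset.mem_filter.2 ⟨Finset.mem_univ _, by rw [← h']; abel⟩
  have h2 := (Finset.card_le_card hcover).trans (Finset.card_union_le _ _)
  rw [Finset.card_univ, card_dir] at h2
  omega

theorem le_card_detours (hS : S ∈ selfAvoiding d N) :
    ((isolatedTimes S).ncard - 1) * (2 * d - 10) ≤ (detours S).card := by
  classical
  set V := (finite_isolatedTimes S).toFinset.erase 0 with hV
  have hVc : (isolatedTimes S).ncard - 1 ≤ V.card := by
    rw [Set.ncard_eq_toFinset_card _ (finite_isolatedTimes S)]
    exact Finset.pred_card_le_card_erase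
  have h : (V.sigma fun n => Finset.univ.filter fun e : Dir d => Allowed S (n, .inr e)).card ≤
      (detours S).card := by
    refine Finset.card_le_card_of_injOn (fun x => (x.1, .inr x.2)) ?_ ?_
    · rintro ⟨n, e⟩ hx
      obtain ⟨-, he⟩ := Finset.mem_sigma.1 hx
      exact Finset.mem_filter.2 ⟨mem_surgeries.2 (Finset.mem_filter.1 he).2, e, rfl⟩
    · rintro ⟨n, e⟩ - ⟨n', e'⟩ - h
      cases h
      rfl
  refine le_trans ?_ h
  rw [Finset.card_sigma]
  refine (Nat.mul_le_mul_right _ hVc).trans ?_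
  rw [← smul_eq_mul]
  refine Finset.card_nsmul_le_sum _ _ _ fun n hn => ?_
  obtain ⟨hn0, hn⟩ := Finset.mem_erase.1 hn
  exact card_detour_dirs hS ((finite_isolatedTimes S).mem_toFinset.1 hn) (by omega)

end Counting

/-! ### Means, concentration and the final estimate -/

section Estimates

variable {d N : ℕ} {S : SiteSeq d N}

/-- The mean number of good modifications of a class, when each uses at most `j` edges. -/
theorem le_sum_goodEvent (hS : S ∈ selfAvoiding d N) {p : unitInterval}
    (hp : 2 * d * (p : ℝ) = 1) (hp45 : 45 * (p : ℝ) ≤ 1) {M : Finset (Surgery d)}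
    (hM : M ⊆ surgeries S) {j : ℕ} (hj : ∀ μ ∈ M, (newEdges S μ).card ≤ j) :
    (M.card : ℝ) * ((p : ℝ) ^ j * (1 - 45 * p)) ≤
      ∑ μ ∈ M, (bernoulliPi _ p).real (goodEvent S μ) := by
  rw [← nsmul_eq_mul]
  exact Finset.card_nsmul_le_sum _ _ _ fun μ hμ =>
    le_goodEvent hS (mem_surgeries.1 (hM hμ)) hp hp45 (hj μ hμ)

/-- Lower bounds for the mean numbers of good chords, flips and detours along a good spine. -/
theorem le_means {ε : ℝ} (hε : 0 < ε) (hε2 : ε ≤ 1 / 2) (hS : S ∈ goodSpines d ε N)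
    {p : unitInterval} (hp : 2 * d * (p : ℝ) = 1) (hp60 : 60 * (p : ℝ) ≤ 1)
    (hN : 3 ≤ (p : ℝ) * N) :
    ((1 - ε) - 60 * p) * (N * (p : ℝ) ^ 2) ≤
        ∑ μ ∈ chords S, (bernoulliPi _ p).real (goodEvent S μ) ∧
      ((1 - ε) - 60 * p) * (N * (p : ℝ) ^ 2) ≤
        ∑ μ ∈ detours S, (bernoulliPi _ p).real (goodEvent S μ) ∧
      ((1 - 2 * ε) - 60 * p) * (N * (p : ℝ) ^ 2) ≤
        ∑ μ ∈ flips S, (bernoulliPi _ p).real (goodEvent S μ) := by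
  classical
  obtain ⟨hsa, hV, hT, hU1, hU2⟩ := hS
  set P : ℝ := (p : ℝ) with hP
  have hP0 : 0 < P := by
    rcases p.2.1.lt_or_eq with h | h
    · exact h
    · rw [← hP] at h; rw [← h] at hp; simp at hp
  have hd : (2 * d : ℝ) = 1 / P := by field_simp; linarith
  have hN0 : (0 : ℝ) < N := by
    by_contra hcon
    have : (N : ℝ) = 0 := le_antisymm (not_lt.1 hcon) (Nat.cast_nonneg N)
    rw [this] at hN; linarith
  have hU1' : (1 - ε) * N * P ≤ (uTurns S).ncard := by
    rw [hd] at hU1; simpa using hU1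
  have hU2' : ((uTurns S).ncard : ℝ) ≤ (1 + ε) * N * P := by
    rw [hd] at hU2; simpa using hU2
  have hcP : (0 : ℝ) ≤ 1 - 45 * P := by linarith
  have hNP : 0 ≤ N * P ^ 2 := by positivity
  refine ⟨?_, ?_, ?_⟩
  · refine le_trans ?_ (le_sum_goodEvent hsa hp (by linarith) (Finset.filter_subset _ _) (j := 1) ?_)
    · have h1 : (1 - ε) * N * P ≤ (chords S).card :=
        hU1'.trans (by exact_mod_cast ncard_uTurns_le S)
      calc ((1 - ε) - 60 * P) * (N * P ^ 2) ≤ ((1 - ε) * (1 - 45 * P)) * (N * P ^ 2) :=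
            mul_le_mul_of_nonneg_right (by nlinarith) hNP
        _ = (1 - ε) * N * P * (P ^ 1 * (1 - 45 * P)) := by ring
        _ ≤ _ := mul_le_mul_of_nonneg_right h1 (by positivity)
    · rintro ⟨n, k⟩ hμ
      obtain ⟨-, rfl⟩ := Finset.mem_filter.1 hμ
      exact (card_newEdges_le n).1
  · refine le_trans ?_ (le_sum_goodEvent hsa hp (by linarith) (Finset.filter_subset _ _) (j := 3) ?_)
    · have h1 : ((isolatedTimes S).ncard - 1 : ℝ) * (2 * d - 10) ≤ (detours S).card := by
        have h2 := le_card_detours hsa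
        have h3 : ((isolatedTimes S).ncard - 1 : ℝ) ≤ (((isolatedTimes S).ncard - 1 : ℕ) : ℝ) := by
          have := Nat.sub_le_iff_le_add.1 (le_refl ((isolatedTimes S).ncard - 1))
          have : ((isolatedTimes S).ncard : ℝ) ≤ (((isolatedTimes S).ncard - 1 : ℕ) : ℝ) + 1 := by
            exact_mod_cast this
          linarith
        have h4 : (2 * d - 10 : ℝ) = ((2 * d - 10 : ℕ) : ℝ) := by
          have : (10 : ℝ) ≤ 2 * d := by
            rw [hd, le_div_iff₀ hP0]; linarith
          have : 10 ≤ 2 * d := by exact_mod_cast this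
          push_cast [this]
          rfl
        rw [h4]
        refine (mul_le_mul_of_nonneg_right h3 (Nat.cast_nonneg _)).trans ?_
        exact_mod_cast h2
      have h5 : ((1 - ε) - P) * N ≤ (isolatedTimes S).ncard - 1 := by nlinarith
      have h6 : (2 * d - 10 : ℝ) * P = 1 - 10 * P := by rw [hd]; field_simp
      have h7 : (0 : ℝ) ≤ 1 - 10 * P := by linarith
      have h8 : ((1 - ε) - 60 * P) ≤ ((1 - ε) - P) * ((1 - 10 * P) * (1 - 45 * P)) := by
        have h9 : 1 - 55 * P ≤ (1 - 10 * P) * (1 - 45 * P) := by nlinarith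
        have h10 : 0 ≤ (1 - ε) - P := by linarith
        nlinarith [mul_le_mul_of_nonneg_left h9 h10]
      calc ((1 - ε) - 60 * P) * (N * P ^ 2)
          ≤ (((1 - ε) - P) * ((1 - 10 * P) * (1 - 45 * P))) * (N * P ^ 2) :=
            mul_le_mul_of_nonneg_right h8 hNP
        _ = (((1 - ε) - P) * N) * ((1 - 10 * P) * (P ^ 2 * (1 - 45 * P))) := by ring
        _ ≤ ((isolatedTimes S).ncard - 1) * ((1 - 10 * P) * (P ^ 2 * (1 - 45 * P))) :=
            mul_le_mul_of_nonneg_right h5 (by positivity)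
        _ = (((isolatedTimes S).ncard - 1) * (2 * d - 10)) * (P ^ 3 * (1 - 45 * P)) := by
            rw [← h6]; ring
        _ ≤ _ := mul_le_mul_of_nonneg_right h1 (by positivity)
    · rintro ⟨n, k⟩ hμ
      obtain ⟨-, e, rfl⟩ := Finset.mem_filter.1 hμ
      exact (card_newEdges_le n).2.2 e
  · refine le_trans ?_ (le_sum_goodEvent hsa hp (by linarith) (Finset.filter_subset _ _) (j := 2) ?_)
    · have h1 : ((isolatedTimes S).ncard : ℝ) ≤
          (flips S).card + (straightTimes S).ncard + (uTurns S).ncard + 3 := by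
        exact_mod_cast ncard_isolatedTimes_le hsa
      have h2 : ((1 - 2 * ε) - 3 * P) * N ≤ (flips S).card := by
        have : ε * (N * P) ≤ 1 / 2 * (N * P) := mul_le_mul_of_nonneg_right hε2 (by positivity)
        nlinarith
      have h8 : ((1 - 2 * ε) - 60 * P) ≤ ((1 - 2 * ε) - 3 * P) * (1 - 45 * P) := by
        nlinarith [mul_pos hε hP0, mul_pos hP0 hP0]
      calc ((1 - 2 * ε) - 60 * P) * (N * P ^ 2)
          ≤ (((1 - 2 * ε) - 3 * P) * (1 - 45 * P)) * (N * P ^ 2) :=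
            mul_le_mul_of_nonneg_right h8 hNP
        _ = (((1 - 2 * ε) - 3 * P) * N) * (P ^ 2 * (1 - 45 * P)) := by ring
        _ ≤ _ := mul_le_mul_of_nonneg_right h2 (by positivity)
    · rintro ⟨n, k⟩ hμ
      obtain ⟨-, rfl⟩ := Finset.mem_filter.1 hμ
      exact (card_newEdges_le n).2.1

open Classical in
/-- Enough good chords, detours and flips produce exponentially many open paths. -/
theorem two_rpow_lt_spineZ (hS : S ∈ selfAvoiding d N) (ω : Env d) {x y L : ℝ}
    (hx1 : x ≤ N)
    (hc : x ≤ {μ ∈ chords S | ω ∈ goodEvent S μ}.card)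
    (hd : x ≤ {μ ∈ detours S | ω ∈ goodEvent S μ}.card)
    (hf : y ≤ {μ ∈ flips S | ω ∈ goodEvent S μ}.card)
    (hL : (2 * N + 3) * (2 : ℝ) ^ L < (2 : ℝ) ^ (2 * x + y)) :
    (2 : ℝ) ^ L < spineZ S ω := by
  have h := le_spineZ hS ω (m := ⌈x⌉₊) (Nat.ceil_le.2 hc) (Nat.ceil_le.2 hd) (f := ⌈y⌉₊)
    (Nat.ceil_le.2 hf)
  set m := ⌈x⌉₊
  set f := ⌈y⌉₊
  have hm : m ≤ N := Nat.ceil_le.2 hx1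
  have h1 : (4 : ℝ) ^ m ≤ (2 * m + 1) * m.centralBinom := by
    exact_mod_cast Nat.four_pow_le_two_mul_add_one_mul_central_binom m
  have h2 : (m.centralBinom : ℝ) * 2 ^ f ≤ spineZ S ω := by exact_mod_cast h
  have h3 : (2 : ℝ) ^ (2 * x + y) ≤ 4 ^ m * 2 ^ f := by
    have h4 : (4 : ℝ) ^ m * 2 ^ f = (2 : ℝ) ^ (2 * (m : ℝ) + f) := by
      rw [Real.rpow_add two_pos, Real.rpow_mul two_pos.le, Real.rpow_natCast, Real.rpow_natCast]
      norm_num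
    rw [h4]
    refine Real.rpow_le_rpow_of_exponent_le one_le_two ?_
    have := Nat.le_ceil x
    have := Nat.le_ceil y
    linarith
  have h5 : (4 : ℝ) ^ m * 2 ^ f ≤ (2 * N + 3) * spineZ S ω := by
    have hmN : (m : ℝ) ≤ N := by exact_mod_cast hm
    calc (4 : ℝ) ^ m * 2 ^ f ≤ (2 * m + 1) * m.centralBinom * 2 ^ f :=
          mul_le_mul_of_nonneg_right h1 (by positivity)
      _ = (2 * m + 1) * (m.centralBinom * 2 ^ f) := by ring
      _ ≤ (2 * N + 3) * spineZ S ω :=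
          mul_le_mul (by linarith) h2 (by positivity) (by positivity)
  exact lt_of_mul_lt_mul_left (hL.trans_le (h3.trans h5)) (by positivity)

/-- The bound at the smallest admissible parameter `p = 1 / (2d)`. The means of the numbers of good chords and
detours are about `(1 - ε) N p ^ 2` and that of good flips about `(1 - 2 ε) N p ^ 2`; the gap
between `3 - 4 ε` and `3 - 6 ε` pays for all the errors. -/
theorem real_spineZ_le {ε : ℝ} (hε : 0 < ε) (hε2 : ε ≤ 1 / 2) (hS : S ∈ goodSpines d ε N)
    {p : unitInterval} (hp : 2 * d * (p : ℝ) = 1) (hpε : 720 * (p : ℝ) ≤ ε)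
    (hN : 3 ≤ (p : ℝ) * N)
    (hL : (2 * N + 3) < (2 : ℝ) ^ (3 / 2 * ε * (p : ℝ) ^ 2 * N)) :
    (bernoulliPi _ p).real {ω : Env d | (spineZ S ω : ℝ) ≤ 2 ^ ((3 - 6 * ε) * N * (p : ℝ) ^ 2)} ≤
      3 * (Fintype.card ((Fin d → ZMod 15) × Kind d) *
        Real.exp (-2 * (ε / 12 * (N * (p : ℝ) ^ 2) /
          Fintype.card ((Fin d → ZMod 15) × Kind d)) ^ 2 / ((N + 1) * (2 * d + 2)))) := by
  classical
  set K : ℝ := (Fintype.card ((Fin d → ZMod 15) × Kind d) : ℝ) with hK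
  set P : ℝ := (p : ℝ) with hP
  have hP0 : 0 < P := by
    rcases p.2.1.lt_or_eq with h | h
    · exact h
    · rw [← hP] at h; rw [← h] at hp; simp at hp
  have hd0 : 0 < d := by
    rcases Nat.eq_zero_or_pos d with h | h
    · subst h; simp at hp
    · exact h
  have hN0 : (0 : ℝ) < N := by
    by_contra hcon
    have : (N : ℝ) = 0 := le_antisymm (not_lt.1 hcon) (Nat.cast_nonneg N)
    rw [this] at hN; linarith
  have hK0 : 0 < K := by
    have : Nonempty (Kind d) := ⟨.inl true⟩
    exact Nat.cast_pos.2 Fintype.card_pos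
  set t := ε / 12 * (N * P ^ 2) / K with ht
  have ht0 : 0 < t := by positivity
  have hKt : K * t = ε / 12 * (N * P ^ 2) := by rw [ht]; field_simp
  obtain ⟨mc, md, mf⟩ := le_means hε hε2 hS hp (by linarith) hN
  have hsa := hS.1
  have hP1 : P ≤ 1 := p.2.2
  have hNP : 0 < N * P ^ 2 := by positivity
  have cc := good_concentration hsa p (M := chords S) (Finset.filter_subset _ _) ht0
  have cd := good_concentration hsa p (M := detours S) (Finset.filter_subset _ _) ht0
  have cf := good_concentration hsa p (M := flips S) (Finset.filter_subset _ _) ht0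
  rw [← hK] at cc cd cf
  set Bad : Finset (Surgery d) → Set (Env d) := fun M =>
    {ω : Env d | (({μ ∈ M | ω ∈ goodEvent S μ}.card : ℕ) : ℝ) ≤
        ∑ μ ∈ M, (bernoulliPi _ p).real (goodEvent S μ) - K * t} with hBad
  have hsub : {ω : Env d | (spineZ S ω : ℝ) ≤ 2 ^ ((3 - 6 * ε) * N * P ^ 2)} ⊆
      Bad (chords S) ∪ (Bad (detours S) ∪ Bad (flips S)) := by
    intro ω hω
    by_contra hcon
    simp only [hBad, Set.mem_union, Set.mem_ofPred_eq, not_or, not_le] at hcon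
    obtain ⟨bc, bd, bf⟩ := hcon
    rw [Set.mem_ofPred_eq] at hω
    refine absurd hω (not_le.2 ?_)
    have hpe : 60 * P ≤ ε / 12 := by linarith
    -- Half of the error `ε / 6` comes from the means, half from the deviations.
    refine two_rpow_lt_spineZ hsa ω (x := (1 - ε - ε / 6) * (N * P ^ 2))
      (y := (1 - 2 * ε - ε / 6) * (N * P ^ 2)) ?_ ?_ ?_ ?_ ?_
    · have h1 : (1 - ε - ε / 6) * (N * P ^ 2) ≤ 1 * (N * P ^ 2) :=
        mul_le_mul_of_nonneg_right (by linarith) hNP.le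
      have h2 : P ^ 2 ≤ 1 := pow_le_one₀ hP0.le hP1
      nlinarith
    · nlinarith [mul_le_mul_of_nonneg_right hpe hNP.le]
    · nlinarith [mul_le_mul_of_nonneg_right hpe hNP.le]
    · nlinarith [mul_le_mul_of_nonneg_right hpe hNP.le]
    · -- The gap `3 ε / 2` absorbs the factor `2 N + 3`.
      have h1 : 2 * ((1 - ε - ε / 6) * (N * P ^ 2)) + (1 - 2 * ε - ε / 6) * (N * P ^ 2) =
          3 / 2 * ε * P ^ 2 * N + (3 - 6 * ε) * N * P ^ 2 := by ring
      rw [h1, Real.rpow_add two_pos]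
      exact mul_lt_mul_of_pos_right hL (by positivity)
  refine (measureReal_mono hsub (measure_ne_top _ _)).trans
    ((measureReal_union_le _ _).trans ?_)
  have := measureReal_union_le (μ := bernoulliPi _ p) (Bad (detours S)) (Bad (flips S))
  linarith

end Estimates

end DiluteLattice

open DiluteLattice in
theorem proposition3p2 (ε : ℝ) (hε : 0 < ε) :
    ∃ d₀ : ℕ, ∀ d : ℕ, d₀ ≤ d → ∃ c : ℝ, 0 < c ∧
      ∀ p : unitInterval, 1 / (2 * (d : ℝ)) ≤ (p : ℝ) →
        ∃ N₀ : ℕ, ∀ N : ℕ, N₀ ≤ N → ∀ S ∈ DiluteLattice.goodSpines d ε N,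
          (DiluteLattice.percolation d p).real
              {ω | (DiluteLattice.spineZ S ω : ℝ) ≤ (2 : ℝ) ^ ((3 - 6 * ε) * N / (2 * (d : ℝ)) ^ 2)}
            ≤ Real.exp (-c * N) := by
  rcases lt_or_ge (1 / 2) ε with hε2 | hε2
  · -- The bound `2 ^ _` is less than one, while the spine itself is always open.
    refine ⟨1, fun d hd => ⟨1, one_pos, fun p _ => ⟨1, fun N hN S hS => ?_⟩⟩⟩
    have hempty : {ω : Env d | (spineZ S ω : ℝ) ≤
        (2 : ℝ) ^ ((3 - 6 * ε) * N / (2 * (d : ℝ)) ^ 2)} = ∅ := by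
      ext ω
      simp only [Set.mem_ofPred_eq, Set.mem_empty_iff_false, iff_false, not_le]
      have hd0 : (0 : ℝ) < d := by exact_mod_cast hd
      have hN0 : (0 : ℝ) < N := by exact_mod_cast hN
      have h1 : (2 : ℝ) ^ ((3 - 6 * ε) * N / (2 * (d : ℝ)) ^ 2) < 1 := by
        refine Real.rpow_lt_one_of_one_lt_of_neg one_lt_two ?_
        exact div_neg_of_neg_of_pos (mul_neg_of_neg_of_pos (by linarith) hN0) (by positivity)
      have h2 : (1 : ℝ) ≤ spineZ S ω := by exact_mod_cast one_le_spineZ hS.1 ω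
      linarith
    rw [hempty]
    simp only [measureReal_empty]
    positivity
  · -- For `d ≥ 360 / ε` the relative error `60 p` of the means is at most `ε / 12`.
    refine ⟨⌈360 / ε⌉₊, fun d hd => ?_⟩
    have hd1 : 360 / ε ≤ d := Nat.ceil_le.1 hd
    have hd0 : (0 : ℝ) < d := lt_of_lt_of_le (by positivity) hd1
    have hdε : 720 * (1 / (2 * (d : ℝ))) ≤ ε := by
      rw [div_le_iff₀ hε] at hd1
      field_simp
      linarith
    let q : unitInterval := ⟨1 / (2 * (d : ℝ)), by positivity, by linarith⟩
    have hq : 2 * d * (q : ℝ) = 1 := by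
      show 2 * d * (1 / (2 * (d : ℝ))) = 1
      field_simp
    have hq0 : 0 < (q : ℝ) := by
      show 0 < 1 / (2 * (d : ℝ))
      positivity
    set K : ℝ := (Fintype.card ((Fin d → ZMod 15) × Kind d) : ℝ) with hK
    have hK0 : 0 < K := by
      have : Nonempty (Kind d) := ⟨.inl true⟩
      exact Nat.cast_pos.2 Fintype.card_pos
    set τ : ℝ := ε / 12 * (q : ℝ) ^ 2 / K with hτ
    have hτ0 : 0 < τ := by positivity
    set c : ℝ := τ ^ 2 / (2 * (2 * d + 2)) with hc
    have hc0 : 0 < c := by positivity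
    refine ⟨c, hc0, fun p hp => ?_⟩
    have hqp : q ≤ p := hp
    have ev1 : ∀ᶠ N : ℕ in Filter.atTop, 3 / (q : ℝ) ≤ N :=
      tendsto_natCast_atTop_atTop.eventually_ge_atTop _
    have ev2 : ∀ᶠ N : ℕ in Filter.atTop, Real.log (3 * K) / c ≤ N :=
      tendsto_natCast_atTop_atTop.eventually_ge_atTop _
    have ev3 : ∀ᶠ N : ℕ in Filter.atTop,
        (2 * N + 3 : ℝ) < (2 : ℝ) ^ (3 / 2 * ε * (q : ℝ) ^ 2 * N) := by
      set r : ℝ := (2 : ℝ) ^ (3 / 2 * ε * (q : ℝ) ^ 2) with hr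
      have hr1 : 1 < r := Real.one_lt_rpow one_lt_two (by positivity)
      have h1 := tendsto_pow_const_div_const_pow_of_one_lt 1 hr1
      have h2 : ∀ᶠ N : ℕ in Filter.atTop, (N : ℝ) ^ 1 / r ^ N < 1 / 5 :=
        h1.eventually_lt_const (by norm_num)
      filter_upwards [h2, Filter.eventually_ge_atTop 1] with N h3 hN
      have hN1 : (1 : ℝ) ≤ N := by exact_mod_cast hN
      rw [div_lt_iff₀ (by positivity)] at h3
      rw [Real.rpow_mul two_pos.le, ← hr, Real.rpow_natCast]
      linarith
    obtain ⟨N₀, hN₀⟩ := Filter.eventually_atTop.1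
      (ev1.and (ev2.and (ev3.and (Filter.eventually_ge_atTop 1))))
    refine ⟨N₀, fun N hN S hS => ?_⟩
    obtain ⟨h1, h2, h3, h4⟩ := hN₀ N hN
    have hN1 : (1 : ℝ) ≤ N := by exact_mod_cast h4
    have hexp : (3 - 6 * ε) * N / (2 * (d : ℝ)) ^ 2 = (3 - 6 * ε) * N * (q : ℝ) ^ 2 := by
      show _ = (3 - 6 * ε) * N * (1 / (2 * (d : ℝ))) ^ 2
      rw [one_div, inv_pow, div_eq_mul_inv]
    rw [hexp]
    have hmono := bernoulliPi_mono hqp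
      (measurableSet_spineZ_le S ((2 : ℝ) ^ ((3 - 6 * ε) * N * (q : ℝ) ^ 2)))
      (fun ω ω' h (hω' : (spineZ S ω' : ℝ) ≤ _) =>
        show (spineZ S ω : ℝ) ≤ _ from (Nat.cast_le.2 (spineZ_mono S h)).trans hω')
    refine le_trans hmono ((real_spineZ_le hε hε2 hS hq hdε
      (by rw [div_le_iff₀ hq0] at h1; linarith) h3).trans ?_)
    rw [← hK]
    have h5 : -2 * (ε / 12 * (N * (q : ℝ) ^ 2) / K) ^ 2 / ((N + 1) * (2 * d + 2)) ≤
        -(2 * c * N) := by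
      have h6 : ε / 12 * (N * (q : ℝ) ^ 2) / K = τ * N := by rw [hτ]; ring
      rw [h6, hc, neg_mul, neg_div, neg_le_neg_iff, le_div_iff₀ (by positivity)]
      have h7 : 2 * (τ ^ 2 / (2 * (2 * d + 2))) * N * ((N + 1) * (2 * (d : ℝ) + 2)) =
          τ ^ 2 * (N * (N + 1)) := by field_simp
      rw [h7, mul_pow]
      nlinarith [mul_le_mul_of_nonneg_left
        (by nlinarith : (N : ℝ) * (N + 1) ≤ 2 * N ^ 2) (sq_nonneg τ)]
    have h8 : 3 * K ≤ Real.exp (c * N) := by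
      rw [div_le_iff₀ hc0] at h2
      rw [← Real.exp_log (show (0 : ℝ) < 3 * K by positivity)]
      exact Real.exp_le_exp.2 (by linarith)
    calc 3 * (K * Real.exp (-2 * (ε / 12 * (N * (q : ℝ) ^ 2) / K) ^ 2 / ((N + 1) * (2 * d + 2))))
        ≤ 3 * (K * Real.exp (-(2 * c * N))) := by gcongr
      _ = (3 * K) * Real.exp (-(2 * c * N)) := by ring
      _ ≤ Real.exp (c * N) * Real.exp (-(2 * c * N)) :=
          mul_le_mul_of_nonneg_right h8 (Real.exp_pos _).le
      _ = Real.exp (-c * N) := by rw [← Real.exp_add]; congr 1; ring
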